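/- Let $L>0$, $\mathbb{T}^3=(\mathbb{R}/L\mathbb{Z})^3$ and $0<T<\infty$. Let $b\in L^\infty(0,T;L^2(\mathbb{T}^3;\mathbb{R}^3))$ be a weak solution, with electric current $\vec j=\nabla\times b$, of the electron magnetohydrodynamic (EMHD) equations $$b_t+\nabla\times[(\nabla\times b)\times b]=0,\qquad \operatorname{div} b=0 .$$ That is, $\vec j$ is measurable on $(0,T)\times\mathbb{T}^3$; for a.e. $t$ one has $\vec j(t)\in L^1(\mathbb{T}^3)$, and $\nabla\times b(t)=\vec j(t)$ and $\operatorname{div}b(t)=0$ hold in the sense of distributions on $\mathbb{T}^3$; moreover $\vec j\times b\in L^1_{\rm loc}((0,T)\times\mathbb{T}^3)$ and $b_t+\nabla\times(\vec j\times b)=0$ in the sense of distributions on $(0,T)\times\mathbb{T}^3$. Let $1<r_1,r_2<\infty$ with $\frac{2}{r_1}+\frac{1}{r_2}=1$, and let $\alpha,\beta\in\mathbb{R}$ with $2\alpha+\beta\ge 1$. Let $C_1,C_2\ge 0$ be integrable functions on $(0,T)$, let $\rho>0$, and let $\sigma_1,\sigma_2$ be real functions on $\mathbb{R}^3$ that are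 non-negative and bounded on $\{|\ell|<\rho\}$. Assume that, for a.e. $t\in(0,T)$ and all $\ell\in\mathbb{R}^3$ with $|\ell|<\rho$, $$\Big(\int_{\mathbb{T}^3}|b(x+\ell,t)-b(x,t)|^{9/2}\,dx\Big)^{2/9}\le C_1(t)^{1/r_1}|\ell|^{\alpha}\sigma_1(\ell)^{1/3},$$ $$\Big(\int_{\mathbb{T}^3}|\vec j(x+\ell,t)-\vec j(x,t)|^{9/5}\,dx\Big)^{5/9}\le C_2(t)^{1/r_2}|\ell|^{\beta}\sigma_2(\ell)^{1/3}.$$ Suppose that at least one of $\sigma_1,\sigma_2$ satisfies $\sigma_i(\ell)\to0$ as $\ell\to0$. Then the dissipation term of the energy vanishes and the energy is conserved. Precisely, let $\varphi(y)=C_0e^{-1/(1-|y|^2)}$ for $|y|<1$ and $\varphi(y)=0$ for $|y|\ge1$, where $C_0$ is such that $\int_{\mathbb{R}^3}\varphi=1$, and put $\varphi_\varepsilon(y)=\varepsilon^{-3}\varphi(y/\varepsilon)$ and $\delta f(\ell)=f(x+\ell,t)-f(x,t)$. Then $$D(b,\vec j;\varepsilon)=\frac18\int_{\mathbb{R}^3}\nabla\varphi_\varepsilon(\ell)\cdot\delta\vec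 j(\ell)\,|\delta b(\ell)|^2\,d\ell-\frac14\int_{\mathbb{R}^3}\nabla\varphi_\varepsilon(\ell)\cdot\delta b(\ell)\,\big(\delta\vec j(\ell)\cdot\delta b(\ell)\big)\,d\ell$$ is integrable on $(0,T)\times\mathbb{T}^3$ for all sufficiently small $\varepsilon>0$ and tends to $0$ in $L^1((0,T)\times\mathbb{T}^3)$ as $\varepsilon\to0^+$ (so its distributional limit $D(b,\vec j)$ is $0$); and there is a constant $E$ such that $$\frac12\int_{\mathbb{T}^3}|b(x,t)|^2\,dx=E\qquad\text{for a.e. }t\in(0,T).$$ -/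

import Mathlib

open Set Filter Topology MeasureTheory
open scoped ContDiff

noncomputable section

namespace EMHD

/-- Three-dimensional Euclidean space. -/
abbrev E3 : Type := EuclideanSpace ℝ (Fin 3)

/-- The flat torus `(ℝ / Lℤ)³`. Its `volume` is the Lebesgue measure, of total mass `L ^ 3`. -/
abbrev Torus (L : ℝ) : Type := Fin 3 → AddCircle L

/-- The quotient map from `ℝ³` onto the torus. -/
def proj (L : ℝ) (y : E3) : Torus L := fun i => (y i : AddCircle L)

/-- The partial derivative `∂ᵢ f` of a function on the torus. -/
def pderiv {L : ℝ} (i : Fin 3) (f : Torus L → ℝ) (x : Torus L) : ℝ :=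
  deriv (fun s : ℝ => f (x + proj L (EuclideanSpace.single i s))) 0

/-- The classical curl `∇ × v` of a vector field on the torus. -/
def curl {L : ℝ} (v : Torus L → E3) (x : Torus L) : E3 :=
  !₂[pderiv 1 (fun y => v y 2) x - pderiv 2 (fun y => v y 1) x,
     pderiv 2 (fun y => v y 0) x - pderiv 0 (fun y => v y 2) x,
     pderiv 0 (fun y => v y 1) x - pderiv 1 (fun y => v y 0) x]

/-- The vector product in `ℝ³`. -/
def cross (u v : E3) : E3 :=
  !₂[u 1 * v 2 - u 2 * v 1, u 2 * v 0 - u 0 * v 2, u 0 * v 1 - u 1 * v 0]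

/-- Smooth functions on the torus: those whose periodic lift to `ℝ³` is smooth. -/
def IsSmooth {L : ℝ} {F : Type} [NormedAddCommGroup F] [NormedSpace ℝ F]
    (f : Torus L → F) : Prop :=
  ContDiff ℝ ∞ (fun y : E3 => f (proj L y))

/-- Vector-valued test functions on `(0,T) × 𝕋³`: smooth in `(t, x)`, and supported in
`[a, c] × 𝕋³` for some `0 < a`, `c < T`. -/
def IsTestField {L : ℝ} (T : ℝ) (Φ : ℝ → Torus L → E3) : Prop :=
  ContDiff ℝ ∞ (fun p : ℝ × E3 => Φ p.1 (proj L p.2)) ∧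
    ∃ a c : ℝ, 0 < a ∧ c < T ∧ ∀ t, t ∉ Icc a c → ∀ x, Φ t x = 0

/-- Lebesgue measure on `(0,T) × 𝕋³`. -/
def spaceTime (L T : ℝ) [Fact (0 < L)] : Measure (ℝ × Torus L) :=
  (volume.restrict (Ioo 0 T)).prod volume

/-- `div v = 0` in the sense of distributions on the torus. -/
def WeakDivFree {L : ℝ} [Fact (0 < L)] (v : Torus L → E3) : Prop :=
  ∀ ψ : Torus L → ℝ, IsSmooth ψ → ∫ x, ∑ i : Fin 3, v x i * pderiv i ψ x = 0

/-- `w = ∇ × v` in the sense of distributions on the torus. -/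
def IsWeakCurl {L : ℝ} [Fact (0 < L)] (v w : Torus L → E3) : Prop :=
  ∀ φ : Torus L → E3, IsSmooth φ → ∫ x, inner ℝ (w x) (φ x) = ∫ x, inner ℝ (v x) (curl φ x)

/-- `b ∈ L^∞(0,T; L²(𝕋³))`, with electric current `j = ∇ × b`, is a weak (distributional) solution
on `(0,T) × 𝕋³` of the EMHD equations `∂ₜ b + ∇ × [(∇ × b) × b] = 0`, `div b = 0`. -/
structure IsWeakSolution {L : ℝ} [Fact (0 < L)] (T : ℝ) (b j : ℝ → Torus L → E3) : Prop where
  measurable_b : AEStronglyMeasurable (fun p : ℝ × Torus L => b p.1 p.2) (spaceTime L T)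
  measurable_j : AEStronglyMeasurable (fun p : ℝ × Torus L => j p.1 p.2) (spaceTime L T)
  finite_energy : ∃ M : ℝ, ∀ᵐ t ∂(volume.restrict (Ioo 0 T)),
    MemLp (b t) 2 volume ∧ eLpNorm (b t) 2 volume ≤ ENNReal.ofReal M
  div_free : ∀ᵐ t ∂(volume.restrict (Ioo 0 T)), WeakDivFree (b t)
  current : ∀ᵐ t ∂(volume.restrict (Ioo 0 T)), Integrable (j t) volume ∧ IsWeakCurl (b t) (j t)
  /-- The nonlinear term is a distribution. -/
  integrable_nonlinearity : LocallyIntegrableOn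
    (fun p : ℝ × Torus L => cross (j p.1 p.2) (b p.1 p.2)) (Ioo 0 T ×ˢ univ)
  equation : ∀ Φ : ℝ → Torus L → E3, IsTestField T Φ →
    ∫ p, (inner ℝ (b p.1 p.2) (deriv (fun s => Φ s p.2) p.1)
      - inner ℝ (cross (j p.1 p.2) (b p.1 p.2)) (curl (Φ p.1) p.2)) ∂(spaceTime L T) = 0

/-- The increment `δf(ℓ) = f(x + ℓ) - f(x)`. -/
def incr {L : ℝ} (f : Torus L → E3) (ℓ : E3) (x : Torus L) : E3 := f (x + proj L ℓ) - f x

/-- The unnormalized standard bump function on `ℝ³`. -/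
def bump (y : E3) : ℝ := if ‖y‖ < 1 then Real.exp (-1 / (1 - ‖y‖ ^ 2)) else 0

/-- The rescaled standard mollifier `φ_ε(y) = ε⁻³ φ(y / ε)`, where `φ` has unit integral. -/
def mollifier (ε : ℝ) (y : E3) : ℝ := (ε ^ 3)⁻¹ * ((∫ z : E3, bump z)⁻¹ * bump (ε⁻¹ • y))

/-- The regularized dissipation term of the energy
`D(b,j;ε) = 1/8 ∫ ∇φ_ε(ℓ)·δj(ℓ) |δb(ℓ)|² dℓ - 1/4 ∫ ∇φ_ε(ℓ)·δb(ℓ) (δj(ℓ)·δb(ℓ)) dℓ`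
at time `t` and position `x`. -/
def dissipation {L : ℝ} (b j : ℝ → Torus L → E3) (ε t : ℝ) (x : Torus L) : ℝ :=
  (1 / 8) * (∫ ℓ : E3, inner ℝ (gradient (mollifier ε) ℓ) (incr (j t) ℓ x)
      * ‖incr (b t) ℓ x‖ ^ 2)
    - (1 / 4) * ∫ ℓ : E3, inner ℝ (gradient (mollifier ε) ℓ) (incr (b t) ℓ x)
      * inner ℝ (incr (j t) ℓ x) (incr (b t) ℓ x)

/-- The energy `½ ∫ |v|² dx`. -/
def energy {L : ℝ} [Fact (0 < L)] (v : Torus L → E3) : ℝ := (1 / 2) * ∫ x, ‖v x‖ ^ 2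

end EMHD

end

/-! Let K be a smooth probability density on the torus living at scale ε, put b_ε(x) = ∫ K(z) b(x +
z) dz, and define j_ε and (j × b)_ε likewise. Mollifying the equation, pairing it with b_ε and
moving the curl gives, weakly in time, d/dt ½‖b_ε‖² = −∫ j_ε · (j × b)_ε. Since j_ε is orthogonal to
j_ε × b_ε, only the commutator (j × b)_ε − j_ε × b_ε contributes. The Constantin-E-Titi identity
`average_cross_sub` expresses it through products of one increment of j and one of b. In the other
factor, j_ε = ∇ × b_ε, the derivative is put on K, which yields a second increment of b at the price
1/ε (`enorm_curlKernel_average_le`).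

Hölder's inequality with 5/9 + 2/9 + 2/9 = 1 then bounds the flux by a constant times ε^(2α+β−1)
C₁^(2/r₁) C₂^(1/r₂) times an arbitrarily small modulus (`enorm_flux_le`, `norm_flux_le`,
`exists_modulus`). The power of ε is at most 1, and weighted AM-GM makes the time factor integrable.
Letting ε → 0, the energy has zero weak derivative, hence is constant
(`ae_eq_const_of_weak_deriv_eq_zero`).

Two points shape the argument. The three increments in the flux carry three different shifts, and
|ℓ|^α or |ℓ|^β alone may blow up at 0 because one exponent may be negative; so K is supported where
ε ≤ |ℓ| ≤ 4ε, and each power is comparable to that of ε (`exists_isAnnularKernel`). Also, b_ε is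
only weakly differentiable in time; the product rule is applied to each coordinate at each fixed x,
where an absolutely continuous representative exists (`IsWeakNegDeriv.sq`).

The dissipation term is estimated directly, independently of the energy balance. There all three
increments share one shift, so the powers combine to |ℓ|^(2α+β) ≤ |ℓ| ≤ ε, which cancels ∫ |∇φ_ε| ≲
1/ε. -/

noncomputable section

namespace EMHD

/-! ### Weak derivatives in one time variable -/

/-- Smooth scalar functions with compact support in the open interval `(a, c)`. -/
structure IsTimeTest (a c : ℝ) (θ : ℝ → ℝ) : Prop where
  smooth : ContDiff ℝ ∞ θ
  support : ∃ a' c' : ℝ, a < a' ∧ c' < c ∧ ∀ t, t ∉ Icc a' c' → θ t = 0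

/-- `-h` is the weak derivative of `g` on `(a, c)`. -/
def IsWeakNegDeriv (a c : ℝ) (g h : ℝ → ℝ) : Prop :=
  ∀ θ, IsTimeTest a c θ → ∫ t in Ioo a c, g t * deriv θ t = ∫ t in Ioo a c, h t * θ t

lemma IsTimeTest.sub_const_mul {a c : ℝ} {θ η : ℝ → ℝ} (h : IsTimeTest a c θ)
    (h' : IsTimeTest a c η) (m : ℝ) : IsTimeTest a c (fun t => θ t - m * η t) := by
  obtain ⟨a₁, c₁, h1, h2, h3⟩ := h.support
  obtain ⟨a₂, c₂, h4, h5, h6⟩ := h'.support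
  refine ⟨h.smooth.sub (contDiff_const.mul h'.smooth), min a₁ a₂, max c₁ c₂, lt_min h1 h4,
    max_lt h2 h5, fun t ht => ?_⟩
  have h7 : t ∉ Icc a₁ c₁ := fun hh => ht ⟨(min_le_left _ _).trans hh.1, hh.2.trans (le_max_left _ _)⟩
  have h8 : t ∉ Icc a₂ c₂ :=
    fun hh => ht ⟨(min_le_right _ _).trans hh.1, hh.2.trans (le_max_right _ _)⟩
  simp [h3 t h7, h6 t h8]

lemma IsTimeTest.eq_zero_of_notMem {a c : ℝ} {θ : ℝ → ℝ} (h : IsTimeTest a c θ) {t : ℝ}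
    (ht : t ∉ Ioo a c) : θ t = 0 := by
  obtain ⟨a₁, c₁, h1, h2, h3⟩ := h.support
  exact h3 t fun hh => ht ⟨h1.trans_le hh.1, hh.2.trans_lt h2⟩

lemma deriv_eq_zero_of_notMem_Icc {θ : ℝ → ℝ} {a' c' : ℝ}
    (h3 : ∀ t, t ∉ Icc a' c' → θ t = 0) {t : ℝ} (ht : t ∉ Icc a' c') : deriv θ t = 0 := by
  have : θ =ᶠ[𝓝 t] fun _ => 0 := by
    filter_upwards [isClosed_Icc.isOpen_compl.mem_nhds ht] with s hs using h3 s hs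
  rw [this.deriv_eq]
  simp

lemma IsTimeTest.continuous_deriv {a c : ℝ} {θ : ℝ → ℝ} (h : IsTimeTest a c θ) :
    Continuous (deriv θ) := h.smooth.continuous_deriv (by simp)

lemma IsTimeTest.hasCompactSupport {a c : ℝ} {θ : ℝ → ℝ} (h : IsTimeTest a c θ) :
    HasCompactSupport θ := by
  obtain ⟨a₁, c₁, h1, h2, h3⟩ := h.support
  exact HasCompactSupport.intro isCompact_Icc h3

lemma IsTimeTest.exists_bound {a c : ℝ} {θ : ℝ → ℝ} (h : IsTimeTest a c θ) :
    ∃ C, 0 ≤ C ∧ (∀ t, ‖θ t‖ ≤ C) ∧ ∀ t, ‖deriv θ t‖ ≤ C := by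
  obtain ⟨C₁, h1⟩ := h.hasCompactSupport.exists_bound_of_continuous h.smooth.continuous
  obtain ⟨C₂, h2⟩ := h.hasCompactSupport.deriv.exists_bound_of_continuous h.continuous_deriv
  exact ⟨max C₁ C₂, ((norm_nonneg _).trans (h1 0)).trans (le_max_left _ _),
    fun t => (h1 t).trans (le_max_left _ _), fun t => (h2 t).trans (le_max_right _ _)⟩

lemma isTimeTest_of_tsupport {a c : ℝ} (hac : a < c) {θ : ℝ → ℝ} (h : ContDiff ℝ ∞ θ)
    (hc : HasCompactSupport θ) (hs : tsupport θ ⊆ Ioo a c) : IsTimeTest a c θ := by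
  refine ⟨h, ?_⟩
  rcases (tsupport θ).eq_empty_or_nonempty with he | hne
  -- The endpoints are reversed so that the interval `Icc c a` is empty.
  · refine ⟨c, a, hac, hac, fun t _ => ?_⟩
    exact image_eq_zero_of_notMem_tsupport (by simp [he])
  · obtain ⟨x, hx⟩ := hc.isCompact.exists_isLeast hne
    obtain ⟨y, hy⟩ := hc.isCompact.exists_isGreatest hne
    refine ⟨x, y, (hs hx.1).1, (hs hy.1).2, fun t ht => ?_⟩
    exact image_eq_zero_of_notMem_tsupport fun hh => ht ⟨hx.2 hh, hy.2 hh⟩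

lemma exists_isTimeTest_integral_eq_one {a c : ℝ} (hac : a < c) :
    ∃ θ, IsTimeTest a c θ ∧ (∀ t, 0 ≤ θ t) ∧ ∫ t, θ t = 1 := by
  let f : ContDiffBump ((a + c) / 2) :=
    { rIn := (c - a) / 8, rOut := (c - a) / 4, rIn_pos := by linarith, rIn_lt_rOut := by linarith }
  refine ⟨f.normed volume, isTimeTest_of_tsupport hac f.contDiff_normed
    f.hasCompactSupport_normed ?_, f.nonneg_normed, f.integral_normed⟩
  rw [f.tsupport_normed_eq, Real.closedBall_eq_Icc]
  have : f.rOut = (c - a) / 4 := rfl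
  rw [this]
  intro t ht
  constructor <;> linarith [ht.1, ht.2]

/-- The primitive vanishes before the support, and after it equals the total integral, which is
zero. -/
lemma IsTimeTest.exists_primitive {a c : ℝ} {ψ : ℝ → ℝ} (h : IsTimeTest a c ψ)
    (h0 : ∫ t, ψ t = 0) : ∃ θ, IsTimeTest a c θ ∧ deriv θ = ψ := by
  obtain ⟨a₁, c₁, h1, h2, h3⟩ := h.support
  have hcont := h.smooth.continuous
  have hd : ∀ t, HasDerivAt (fun t => ∫ s in a..t, ψ s) (ψ t) t := fun t =>
    intervalIntegral.integral_hasDerivAt_right (hcont.intervalIntegrable _ _)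
      (hcont.stronglyMeasurableAtFilter _ _) hcont.continuousAt
  have hd' : deriv (fun t => ∫ s in a..t, ψ s) = ψ := funext fun t => (hd t).deriv
  have hz : ∀ {x y}, Ioc x y ∩ Icc a₁ c₁ = ∅ → ∫ s in Ioc x y, ψ s = 0 := by
    intro x y hxy
    refine setIntegral_eq_zero_of_forall_eq_zero fun s hs => h3 s fun hh => ?_
    have : s ∈ Ioc x y ∩ Icc a₁ c₁ := ⟨hs, hh⟩
    rw [hxy] at this
    exact this
  refine ⟨fun t => ∫ s in a..t, ψ s, ⟨?_, a₁, c₁, h1, h2, fun t ht => ?_⟩, hd'⟩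
  · rw [contDiff_infty_iff_deriv, hd']
    exact ⟨fun t => (hd t).differentiableAt, h.smooth⟩
  · rcases lt_or_ge t a₁ with hlt | hge
    · simp only [intervalIntegral]
      rw [hz, hz, sub_zero]
      · ext s; simp only [mem_inter_iff, mem_Ioc, mem_Icc, mem_empty_iff_false, iff_false]
        rintro ⟨⟨_, _⟩, _, _⟩; linarith
      · ext s; simp only [mem_inter_iff, mem_Ioc, mem_Icc, mem_empty_iff_false, iff_false]
        rintro ⟨⟨_, _⟩, _, _⟩; linarith
    · have hct : c₁ < t := by
        by_contra hh
        exact ht ⟨hge, not_lt.mp hh⟩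
      have hat : a ≤ t := by linarith
      show ∫ s in a..t, ψ s = 0
      rw [intervalIntegral.integral_of_le hat, ← h0]
      refine setIntegral_eq_integral_of_forall_compl_eq_zero fun s hs => h3 s fun hh => hs ?_
      exact ⟨h1.trans_le hh.1, hh.2.trans hct.le⟩

/-- A function on an interval whose weak derivative vanishes is constant. -/
lemma ae_eq_const_of_weak_deriv_eq_zero {a c : ℝ} (hac : a < c) {g : ℝ → ℝ}
    (hg : IntegrableOn g (Ioo a c))
    (h : ∀ θ, IsTimeTest a c θ → ∫ t in Ioo a c, g t * deriv θ t = 0) :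
    ∃ k, ∀ᵐ t ∂(volume.restrict (Ioo a c)), g t = k := by
  obtain ⟨θ₀, hθ₀, -, hone⟩ := exists_isTimeTest_integral_eq_one hac
  have hint : ∀ {θ}, IsTimeTest a c θ → IntegrableOn (fun t => g t * θ t) (Ioo a c) := by
    intro θ hθ
    obtain ⟨C, -, hC, -⟩ := hθ.exists_bound
    exact Integrable.mul_bdd hg hθ.smooth.continuous.aestronglyMeasurable (ae_of_all _ hC)
  have hint' : ∀ {θ}, IsTimeTest a c θ → Integrable θ := fun hθ =>
    hθ.smooth.continuous.integrable_of_hasCompactSupport hθ.hasCompactSupport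
  set k := ∫ t in Ioo a c, g t * θ₀ t with hk
  refine ⟨k, ?_⟩
  have hloc : LocallyIntegrableOn (fun t => g t - k) (Ioo a c) :=
    (hg.sub (integrableOn_const (by simp))).locallyIntegrableOn
  have key := IsOpen.ae_eq_zero_of_integral_contDiff_smul_eq_zero isOpen_Ioo hloc ?_
  · rw [ae_restrict_iff' measurableSet_Ioo]
    filter_upwards [key] with t ht htm
    linarith [ht htm]
  · intro ζ hζ hζc hζs
    have hζt := isTimeTest_of_tsupport hac hζ hζc hζs
    set m := ∫ t, ζ t with hm
    -- Subtracting the right multiple of `θ₀` leaves mean zero, so the difference is the derivative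
    -- of a test function and the hypothesis applies to it.
    have hψ := hζt.sub_const_mul hθ₀ m
    obtain ⟨θ, hθ, hθd⟩ := hψ.exists_primitive (by
      rw [integral_sub (hint' hζt) ((hint' hθ₀).const_mul m), integral_const_mul, hone]
      simp [hm])
    have h1 := h θ hθ
    rw [hθd] at h1
    have e1 : ∫ t in Ioo a c, g t * (ζ t - m * θ₀ t)
        = (∫ t in Ioo a c, g t * ζ t) - m * k := by
      have : (fun t => g t * (ζ t - m * θ₀ t)) = fun t => g t * ζ t - m * (g t * θ₀ t) := by
        ext t; ring
      rw [this, integral_sub (hint hζt) ((hint hθ₀).const_mul m), integral_const_mul]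
    have e2 : ∫ t, ζ t • (g t - k) = ∫ t in Ioo a c, ζ t • (g t - k) := by
      refine (setIntegral_eq_integral_of_forall_compl_eq_zero fun t ht => ?_).symm
      rw [hζt.eq_zero_of_notMem ht, zero_smul]
    have e3 : ∫ t in Ioo a c, ζ t = m :=
      setIntegral_eq_integral_of_forall_compl_eq_zero fun t ht => hζt.eq_zero_of_notMem ht
    have : (fun t => ζ t • (g t - k)) = fun t => g t * ζ t - k * ζ t := by
      ext t; simp only [smul_eq_mul]; ring
    rw [e2, this, integral_sub (hint hζt) ((hint' hζt).integrableOn.const_mul k),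
      integral_const_mul, e3]
    rw [e1] at h1
    linarith

/-- A function with an integrable weak derivative agrees almost everywhere with an absolutely
continuous function, whose derivative is the weak derivative. -/
lemma IsWeakNegDeriv.exists_absolutelyContinuous {a c : ℝ} (hac : a < c) {g h : ℝ → ℝ}
    (hg : IntegrableOn g (Ioo a c)) (hh : IntegrableOn h (Ioo a c)) (H : IsWeakNegDeriv a c g h) :
    ∃ G : ℝ → ℝ, AbsolutelyContinuousOnInterval G a c ∧
      (∀ᵐ t ∂(volume.restrict (Ioo a c)), g t = G t) ∧
      ∀ᵐ t ∂(volume.restrict (Ioo a c)), HasDerivAt G (-h t) t := by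
  have hhi : IntervalIntegrable h volume a c :=
    (intervalIntegrable_iff_integrableOn_Ioo_of_le hac.le).2 hh
  set P : ℝ → ℝ := fun t => ∫ s in a..t, h s with hP
  have hPac : AbsolutelyContinuousOnInterval P a c :=
    hhi.absolutelyContinuousOnInterval_intervalIntegral (by simp)
  have hPd : ∀ᵐ t ∂(volume.restrict (Ioo a c)), HasDerivAt P (h t) t := by
    rw [ae_restrict_iff' measurableSet_Ioo]
    filter_upwards [hhi.ae_hasDerivAt_integral] with t ht htm
    exact ht (by rw [uIcc_of_le hac.le]; exact Ioo_subset_Icc_self htm) a (by simp)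
  have hPint : IntegrableOn P (Ioo a c) :=
    (intervalIntegrable_iff_integrableOn_Ioo_of_le hac.le).1 hPac.continuousOn.intervalIntegrable
  -- Integration by parts against the primitive `P` of `h` shows that `g + P` has zero weak
  -- derivative, so `g = k - P` almost everywhere.
  obtain ⟨k, hk⟩ := ae_eq_const_of_weak_deriv_eq_zero hac (hg.add hPint) (by
    intro θ hθ
    obtain ⟨C, -, -, hC⟩ := hθ.exists_bound
    have hθac : AbsolutelyContinuousOnInterval θ a c :=
      (hθ.smooth.of_le (by simp)).contDiffOn.absolutelyContinuousOnInterval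
    have i1 : IntegrableOn (fun t => g t * deriv θ t) (Ioo a c) :=
      Integrable.mul_bdd hg hθ.continuous_deriv.aestronglyMeasurable (ae_of_all _ hC)
    have i2 : IntegrableOn (fun t => P t * deriv θ t) (Ioo a c) :=
      Integrable.mul_bdd hPint hθ.continuous_deriv.aestronglyMeasurable (ae_of_all _ hC)
    have e1 := hPac.integral_mul_deriv_eq_deriv_mul hθac
    rw [hθ.eq_zero_of_notMem (t := a) (by simp), hθ.eq_zero_of_notMem (t := c) (by simp),
      intervalIntegral.integral_of_le hac.le, intervalIntegral.integral_of_le hac.le,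
      integral_Ioc_eq_integral_Ioo, integral_Ioc_eq_integral_Ioo] at e1
    have e2 : ∫ t in Ioo a c, deriv P t * θ t = ∫ t in Ioo a c, h t * θ t := by
      refine integral_congr_ae ?_
      filter_upwards [hPd] with t ht
      rw [ht.deriv]
    have e3 : ∀ t, (g + P) t * deriv θ t = g t * deriv θ t + P t * deriv θ t := by
      intro t; simp only [Pi.add_apply]; ring
    simp_rw [e3]
    rw [integral_add i1 i2, H θ hθ, e1, e2]
    ring)
  refine ⟨fun t => k - P t, ?_, ?_, ?_⟩
  · have : AbsolutelyContinuousOnInterval (fun _ : ℝ => k) a c :=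
      contDiffOn_const.absolutelyContinuousOnInterval
    exact this.sub hPac
  · filter_upwards [hk] with t ht
    simp only [Pi.add_apply] at ht
    linarith
  · filter_upwards [hPd] with t ht
    simpa using ht.const_sub k

/-- The product rule for the weak derivative of a square. -/
lemma IsWeakNegDeriv.sq {a c : ℝ} (hac : a < c) {g h : ℝ → ℝ}
    (hg : IntegrableOn g (Ioo a c)) (hh : IntegrableOn h (Ioo a c)) (H : IsWeakNegDeriv a c g h) :
    IsWeakNegDeriv a c (fun t => g t ^ 2) (fun t => 2 * (g t * h t)) := by
  obtain ⟨G, hGac, hgG, hGd⟩ := H.exists_absolutelyContinuous hac hg hh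
  intro θ hθ
  have hθac : AbsolutelyContinuousOnInterval θ a c :=
    (hθ.smooth.of_le (by simp)).contDiffOn.absolutelyContinuousOnInterval
  have e1 := (hGac.mul hGac).integral_mul_deriv_eq_deriv_mul hθac
  rw [hθ.eq_zero_of_notMem (t := a) (by simp), hθ.eq_zero_of_notMem (t := c) (by simp),
    intervalIntegral.integral_of_le hac.le, intervalIntegral.integral_of_le hac.le,
    integral_Ioc_eq_integral_Ioo, integral_Ioc_eq_integral_Ioo] at e1
  have e2 : ∫ t in Ioo a c, g t ^ 2 * deriv θ t = ∫ t in Ioo a c, (G * G) t * deriv θ t := by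
    refine integral_congr_ae ?_
    filter_upwards [hgG] with t ht
    rw [ht, Pi.mul_apply, pow_two]
  have e3 : ∫ t in Ioo a c, deriv (G * G) t * θ t
      = - ∫ t in Ioo a c, 2 * (g t * h t) * θ t := by
    rw [← integral_neg]
    refine integral_congr_ae ?_
    filter_upwards [hgG, hGd] with t ht ht'
    rw [(ht'.mul ht').deriv, ht]
    ring
  rw [e2, e1, e3]
  ring

/-! ### Calculus on the torus through the covering map -/

section proj

variable {L : ℝ}

lemma proj_add (y z : E3) : proj L (y + z) = proj L y + proj L z := by
  ext i; simp [proj]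

lemma proj_sub (y z : E3) : proj L (y - z) = proj L y - proj L z := by
  ext i; simp [proj]

lemma isOpenQuotientMap_proj : IsOpenQuotientMap (proj L) := by
  have h1 : IsOpenQuotientMap (Pi.map fun _ : Fin 3 => ((↑) : ℝ → AddCircle L)) :=
    IsOpenQuotientMap.piMap fun _ => QuotientAddGroup.isOpenQuotientMap_mk
  exact h1.comp (EuclideanSpace.equiv (Fin 3) ℝ).toHomeomorph.isOpenQuotientMap

lemma continuous_proj : Continuous (proj L) := isOpenQuotientMap_proj.continuous

lemma proj_surjective : Function.Surjective (proj L) := isOpenQuotientMap_proj.surjective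

lemma IsSmooth.continuous {F : Type} [NormedAddCommGroup F] [NormedSpace ℝ F] {f : Torus L → F}
    (hf : IsSmooth f) : Continuous f :=
  isOpenQuotientMap_proj.continuous_comp_iff.1 (ContDiff.continuous hf)

lemma IsSmooth.hasDerivAt {f : Torus L → ℝ} (hf : IsSmooth f) (i : Fin 3) (y : E3) :
    HasDerivAt (fun s : ℝ => f (proj L y + proj L (EuclideanSpace.single i s)))
      (fderiv ℝ (fun y => f (proj L y)) y (EuclideanSpace.single i 1)) 0 := by
  have h1 : (fun s : ℝ => f (proj L y + proj L (EuclideanSpace.single i s)))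
      = fun s : ℝ => (fun y => f (proj L y)) (y + s • EuclideanSpace.single i (1 : ℝ)) := by
    ext s
    rw [← proj_add]
    congr 3
    ext j
    simp
  rw [h1]
  have h2 : HasFDerivAt (fun y => f (proj L y)) (fderiv ℝ (fun y => f (proj L y)) y)
      (y + (0 : ℝ) • EuclideanSpace.single i (1 : ℝ)) := by
    rw [zero_smul, add_zero]
    exact (ContDiff.differentiable hf (by simp) y).hasFDerivAt
  have h3 : HasDerivAt (fun s : ℝ => y + s • EuclideanSpace.single i (1 : ℝ))
      (EuclideanSpace.single i (1 : ℝ)) 0 := by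
    simpa using ((hasDerivAt_id (0 : ℝ)).smul_const (EuclideanSpace.single i (1 : ℝ))).const_add y
  exact h2.comp_hasDerivAt (0 : ℝ) h3

lemma IsSmooth.pderiv_proj {f : Torus L → ℝ} (hf : IsSmooth f) (i : Fin 3) (y : E3) :
    pderiv i f (proj L y) = fderiv ℝ (fun y => f (proj L y)) y (EuclideanSpace.single i 1) :=
  (hf.hasDerivAt i y).deriv

lemma IsSmooth.pderiv {f : Torus L → ℝ} (hf : IsSmooth f) (i : Fin 3) :
    IsSmooth (pderiv i f) := by
  unfold IsSmooth
  simp_rw [hf.pderiv_proj i]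
  exact (ContDiff.fderiv_right hf (m := ∞) (by simp)).clm_apply contDiff_const

lemma IsSmooth.comp_sub_right {F : Type} [NormedAddCommGroup F] [NormedSpace ℝ F]
    {f : Torus L → F} (hf : IsSmooth f) (x : Torus L) : IsSmooth (fun y => f (y - x)) := by
  obtain ⟨x, rfl⟩ := proj_surjective x
  unfold IsSmooth
  simp_rw [← proj_sub]
  exact ContDiff.comp (g := fun y => f (proj L y)) hf (contDiff_id.sub contDiff_const)

lemma IsSmooth.comp_const_sub {F : Type} [NormedAddCommGroup F] [NormedSpace ℝ F]
    {f : Torus L → F} (hf : IsSmooth f) (x : Torus L) : IsSmooth (fun y => f (x - y)) := by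
  obtain ⟨x, rfl⟩ := proj_surjective x
  unfold IsSmooth
  simp_rw [← proj_sub]
  exact ContDiff.comp (g := fun y => f (proj L y)) hf (contDiff_const.sub contDiff_id)

lemma IsSmooth.smul_const {f : Torus L → ℝ} (hf : IsSmooth f) (e : E3) :
    IsSmooth (fun y => f y • e) := ContDiff.smul hf contDiff_const

/-- The gradient of a scalar function on the torus. -/
def torusGrad (f : Torus L → ℝ) (x : Torus L) : E3 := !₂[pderiv 0 f x, pderiv 1 f x, pderiv 2 f x]

lemma continuous_torusGrad {f : Torus L → ℝ} (hf : IsSmooth f) : Continuous (torusGrad f) := by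
  refine (PiLp.continuous_toLp 2 _).comp (continuous_pi fun i => ?_)
  fin_cases i
  exacts [(hf.pderiv 0).continuous, (hf.pderiv 1).continuous, (hf.pderiv 2).continuous]

lemma pderiv_comp_sub_right (f : Torus L → ℝ) (i : Fin 3) (x y : Torus L) :
    pderiv i (fun y => f (y - x)) y = pderiv i f (y - x) := by
  unfold pderiv
  simp_rw [add_sub_right_comm]

lemma pderiv_comp_const_sub (f : Torus L → ℝ) (i : Fin 3) (x y : Torus L) :
    pderiv i (fun y => f (x - y)) y = - pderiv i f (x - y) := by
  unfold pderiv
  have h : (fun s : ℝ => f (x - (y + proj L (EuclideanSpace.single i s))))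
      = fun s : ℝ => (fun s => f (x - y + proj L (EuclideanSpace.single i s))) (-s) := by
    ext s
    have : proj L (EuclideanSpace.single i (-s)) = - proj L (EuclideanSpace.single i s) := by
      rw [← zero_sub, ← sub_zero (0 : ℝ), ← zero_sub (proj L _)]
      have h0 : (0 : Torus L) = proj L 0 := by ext i; simp [proj]
      rw [h0, ← proj_sub]
      congr 1
      ext j
      by_cases hj : j = i <;> simp [hj]
    simp only [this]
    congr 1
    abel
  rw [h, deriv_comp_neg (f := fun s => f (x - y + proj L (EuclideanSpace.single i s))) 0, neg_zero]

lemma torusGrad_comp_sub_right (f : Torus L → ℝ) (x y : Torus L) :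
    torusGrad (fun y => f (y - x)) y = torusGrad f (y - x) := by
  simp [torusGrad, pderiv_comp_sub_right]

lemma torusGrad_comp_const_sub (f : Torus L → ℝ) (x y : Torus L) :
    torusGrad (fun y => f (x - y)) y = - torusGrad f (x - y) := by
  ext i
  fin_cases i <;> simp [torusGrad, pderiv_comp_const_sub]

lemma torusGrad_const_mul (f : Torus L → ℝ) (c : ℝ) (y : Torus L) :
    torusGrad (fun y => c * f y) y = c • torusGrad f y := by
  ext i
  fin_cases i <;> simp [torusGrad, pderiv, deriv_const_mul_field]

end proj

/-! ### Vector algebra in ℝ³ -/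

section cross

/-- The vector product as a continuous bilinear map. -/
def crossL : E3 →L[ℝ] E3 →L[ℝ] E3 :=
  LinearMap.toContinuousBilinearMap <| LinearMap.mk₂ ℝ cross
    (by intro u v w; ext i; fin_cases i <;> simp [cross] <;> ring)
    (by intro c u v; ext i; fin_cases i <;> simp [cross] <;> ring)
    (by intro u v w; ext i; fin_cases i <;> simp [cross] <;> ring)
    (by intro c u v; ext i; fin_cases i <;> simp [cross] <;> ring)

@[simp] lemma crossL_apply (u v : E3) : crossL u v = cross u v := rfl

lemma continuous_cross : Continuous fun p : E3 × E3 => cross p.1 p.2 :=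
  crossL.continuous₂

lemma inner_eq (u v : E3) : inner ℝ u v = u 0 * v 0 + u 1 * v 1 + u 2 * v 2 := by
  simp [PiLp.inner_apply, Fin.sum_univ_three, mul_comm]

lemma norm_sq_eq (u : E3) : ‖u‖ ^ 2 = u 0 ^ 2 + u 1 ^ 2 + u 2 ^ 2 := by
  simp [EuclideanSpace.norm_sq_eq, Fin.sum_univ_three]

lemma norm_cross_le (u v : E3) : ‖cross u v‖ ≤ ‖u‖ * ‖v‖ := by
  rw [← sq_le_sq₀ (norm_nonneg _) (by positivity), mul_pow, norm_sq_eq, norm_sq_eq, norm_sq_eq]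
  simp only [cross, PiLp.toLp_apply, Matrix.cons_val]
  nlinarith [sq_nonneg (u 0 * v 0 + u 1 * v 1 + u 2 * v 2)]

lemma inner_cross_cyclic (u v w : E3) : inner ℝ u (cross v w) = inner ℝ (cross u v) w := by
  simp [inner_eq, cross]; ring

lemma inner_cross_self_left (u v : E3) : inner ℝ (cross u v) u = 0 := by
  simp [inner_eq, cross]; ring

lemma cross_sub_sub (u u' v v' : E3) :
    cross (u - u') (v - v') = cross u v - cross u v' - cross u' v + cross u' v' := by
  ext i; fin_cases i <;> simp [cross] <;> ring

lemma curl_smul_const {L : ℝ} (f : Torus L → ℝ) (e : E3) (x : Torus L) :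
    curl (fun y => f y • e) x = cross (torusGrad f x) e := by
  ext i
  fin_cases i <;> simp [curl, cross, torusGrad, pderiv, deriv_mul_const_field]

end cross

/-! ### Boundedness and measurability on the torus -/

section measure

variable {L : ℝ} [Fact (0 < L)]

instance : IsFiniteMeasure (volume : Measure (Torus L)) := by
  unfold Torus; infer_instance

instance : MeasurableAdd₂ (Torus L) := by
  unfold Torus; infer_instance

lemma exists_bound_of_continuous {F : Type} [NormedAddCommGroup F] {f : Torus L → F}
    (hf : Continuous f) : ∃ C, 0 ≤ C ∧ ∀ x, ‖f x‖ ≤ C := by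
  obtain ⟨C, hC⟩ := isCompact_univ.exists_bound_of_continuousOn hf.continuousOn
  exact ⟨C, (norm_nonneg _).trans (hC 0 (mem_univ _)), fun x => hC x (mem_univ _)⟩

omit [Fact (0 < L)] in
lemma measurable_proj : Measurable (proj L) := continuous_proj.measurable

end measure

/-! ### Periodization of bumps supported inside one period -/

section circle

variable {L : ℝ} [hL : Fact (0 < L)]

/-- Just outside the fundamental period both sides vanish, so the agreement holds on an open
interval around `[0, L]`. That margin is what makes smoothness at the seam automatic. -/
lemma liftIco_coe_eq_of_mem {a c : ℝ} (ha : 0 < a) (hac : a ≤ c) (hc : c < L) {f : ℝ → ℝ}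
    (hf : ∀ t, t ∉ Icc a c → f t = 0) {y : ℝ} (hy : y ∈ Ioo (c - L) (L + a)) :
    AddCircle.liftIco L 0 f (y : AddCircle L) = f y := by
  have h2 := hy.1
  have h3 := hy.2
  rcases lt_or_ge y 0 with h0 | h0
  · have : (y : AddCircle L) = ((y + L : ℝ) : AddCircle L) := by simp
    rw [this, AddCircle.liftIco_zero_coe_apply ⟨by linarith, by linarith⟩, hf, hf]
    · intro h; linarith [h.1]
    · intro h; linarith [h.2]
  · rcases lt_or_ge y L with h1 | h1
    · exact AddCircle.liftIco_zero_coe_apply ⟨h0, h1⟩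
    · have : (y : AddCircle L) = ((y - L : ℝ) : AddCircle L) := by
        rw [AddCircle.coe_sub, AddCircle.coe_period, sub_zero]
      rw [this, AddCircle.liftIco_zero_coe_apply ⟨by linarith, by linarith⟩, hf, hf]
      · intro h; linarith [h.2]
      · intro h; linarith [h.1]

/-- The shift is the start of the period containing `y`. It is chosen before `f`, so that a function
and its derivative can use the same one. -/
lemma exists_liftIco_eventuallyEq {a c : ℝ} (ha : 0 < a) (hac : a ≤ c) (hc : c < L) (y : ℝ) :
    ∃ r : ℝ, ∀ f : ℝ → ℝ, (∀ t, t ∉ Icc a c → f t = 0) →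
      (fun s : ℝ => AddCircle.liftIco L 0 f (s : AddCircle L)) =ᶠ[𝓝 y] fun s => f (s - r) := by
  have hL0 := hL.out
  refine ⟨⌊y / L⌋ * L, fun f hf => ?_⟩
  have h1 : (⌊y / L⌋ : ℝ) * L ≤ y := (le_div_iff₀ hL0).1 (Int.floor_le _)
  have h2 : y < (⌊y / L⌋ + 1 : ℝ) * L := (div_lt_iff₀ hL0).1 (Int.lt_floor_add_one _)
  have h3 : Ioo (c - L + ⌊y / L⌋ * L) (L + a + ⌊y / L⌋ * L) ∈ 𝓝 y :=
    Ioo_mem_nhds (by linarith) (by linarith)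
  filter_upwards [h3] with s hs
  have h4 : (s : AddCircle L) = ((s - ⌊y / L⌋ * L : ℝ) : AddCircle L) := by
    have : ((⌊y / L⌋ * L : ℝ) : AddCircle L) = 0 := by
      rw [← zsmul_eq_mul, AddCircle.coe_zsmul, AddCircle.coe_period, smul_zero]
    rw [AddCircle.coe_sub, this, sub_zero]
  rw [h4]
  exact liftIco_coe_eq_of_mem ha hac hc hf ⟨by linarith [hs.1], by linarith [hs.2]⟩

lemma contDiff_liftIco {a c : ℝ} (ha : 0 < a) (hac : a ≤ c) (hc : c < L) {f : ℝ → ℝ}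
    (hf : ∀ t, t ∉ Icc a c → f t = 0) (hs : ContDiff ℝ ∞ f) :
    ContDiff ℝ ∞ (fun s : ℝ => AddCircle.liftIco L 0 f (s : AddCircle L)) := by
  rw [contDiff_iff_contDiffAt]
  intro y
  obtain ⟨r, hr⟩ := exists_liftIco_eventuallyEq (L := L) ha hac hc y
  exact (hs.comp (contDiff_id.sub contDiff_const)).contDiffAt.congr_of_eventuallyEq (hr f hf)

lemma hasDerivAt_liftIco {a c : ℝ} (ha : 0 < a) (hac : a ≤ c) (hc : c < L) {f : ℝ → ℝ}
    (hf : ∀ t, t ∉ Icc a c → f t = 0) (hs : ContDiff ℝ ∞ f) (y : ℝ) :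
    HasDerivAt (fun s : ℝ => AddCircle.liftIco L 0 f (s : AddCircle L))
      (AddCircle.liftIco L 0 (deriv f) (y : AddCircle L)) y := by
  obtain ⟨r, hr⟩ := exists_liftIco_eventuallyEq (L := L) ha hac hc y
  rw [(hr _ fun t ht => deriv_eq_zero_of_notMem_Icc hf ht).eq_of_nhds]
  refine HasDerivAt.congr_of_eventuallyEq ?_ (hr f hf)
  have := ((hs.differentiable (by simp)) (y - r)).hasDerivAt
  exact this.comp_sub_const y r

lemma integral_liftIco {a c : ℝ} (ha : 0 < a) (hac : a ≤ c) (hc : c < L) {f : ℝ → ℝ}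
    (hf : ∀ t, t ∉ Icc a c → f t = 0) :
    ∫ z : AddCircle L, AddCircle.liftIco L 0 f z = ∫ t, f t := by
  have hL0 := hL.out
  rw [← AddCircle.integral_preimage L 0]
  rw [← setIntegral_eq_integral_of_forall_compl_eq_zero (s := Ioc 0 (0 + L)) (f := f)]
  · refine setIntegral_congr_fun measurableSet_Ioc fun y hy => ?_
    exact liftIco_coe_eq_of_mem ha hac hc hf
      ⟨by linarith [hy.1], by linarith [hy.2]⟩
  · intro t ht
    refine hf t fun h => ht ⟨by linarith [h.1], by linarith [h.2]⟩

lemma exists_rep_of_liftIco_ne_zero {a c : ℝ} {f : ℝ → ℝ} (hf : ∀ t, t ∉ Icc a c → f t = 0)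
    {z : AddCircle L} (hz : AddCircle.liftIco L 0 f z ≠ 0) : ∃ y ∈ Icc a c, (y : AddCircle L) = z := by
  refine ⟨AddCircle.equivIco L 0 z, ?_, AddCircle.coe_equivIco⟩
  by_contra h
  exact hz (hf _ h)

end circle

/-! ### One-dimensional bumps at scale ε -/

section bump

/-- One fixed bump supported in (1, 2) is rescaled. Scaling gives the factor 1/ε on the derivative,
with `A` independent of ε. -/
lemma exists_scaled_bump : ∃ A : ℝ, 0 ≤ A ∧ ∀ ε : ℝ, 0 < ε → ∃ f : ℝ → ℝ, ContDiff ℝ ∞ f ∧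
    (∀ t, 0 ≤ f t) ∧ (∀ t, t ∉ Icc ε (2 * ε) → f t = 0) ∧ ∫ t, f t = 1 ∧ ∫ t, deriv f t = 0 ∧
    ∫ t, |deriv f t| ≤ A / ε := by
  obtain ⟨θ, hθ, hpos, hone⟩ := exists_isTimeTest_integral_eq_one (a := 1) (c := 2) (by norm_num)
  refine ⟨∫ t, |deriv θ t|, integral_nonneg fun _ => abs_nonneg _, fun ε hε => ?_⟩
  have hd : ∀ t, deriv (fun t => ε⁻¹ * θ (ε⁻¹ * t)) t = ε⁻¹ * (ε⁻¹ * deriv θ (ε⁻¹ * t)) := by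
    intro t
    rw [deriv_const_mul_field, deriv_comp_mul_left, smul_eq_mul]
  have hscale : ∀ g : ℝ → ℝ, ∫ t, ε⁻¹ * g (ε⁻¹ * t) = ∫ t, g t := by
    intro g
    rw [integral_const_mul, Measure.integral_comp_mul_left, inv_inv, abs_of_pos hε, smul_eq_mul,
      inv_mul_cancel_left₀ hε.ne']
  refine ⟨fun t => ε⁻¹ * θ (ε⁻¹ * t), contDiff_const.mul (hθ.smooth.comp
    (contDiff_const.mul contDiff_id)), fun t => mul_nonneg (by positivity) (hpos _), ?_, ?_, ?_, ?_⟩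
  · intro t ht
    have : ε⁻¹ * t ∉ Ioo (1 : ℝ) 2 := by
      rintro ⟨h1, h2⟩
      rw [inv_mul_eq_div, lt_div_iff₀ hε] at h1
      rw [inv_mul_eq_div, div_lt_iff₀ hε] at h2
      exact ht ⟨by linarith, h2.le⟩
    simp [hθ.eq_zero_of_notMem this]
  · rw [hscale, hone]
  · simp_rw [hd]
    rw [integral_const_mul, hscale (fun t => deriv θ t),
      integral_eq_zero_of_hasDerivAt_of_integrable (f := θ)
        (fun x => ((hθ.smooth.differentiable (by simp)) x).hasDerivAt)
        (hθ.continuous_deriv.integrable_of_hasCompactSupport hθ.hasCompactSupport.deriv)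
        (hθ.smooth.continuous.integrable_of_hasCompactSupport hθ.hasCompactSupport), mul_zero]
  · simp_rw [hd, abs_mul, abs_of_pos (inv_pos.2 hε)]
    rw [integral_const_mul, hscale (fun t => |deriv θ t|), inv_mul_eq_div]

end bump

/-! ### The annular mollifier -/

section kernel

variable {L : ℝ} [hL : Fact (0 < L)]

lemma integrable_of_continuous {F : Type} [NormedAddCommGroup F] {f : Torus L → F}
    [SecondCountableTopologyEither (Torus L) F] (hf : Continuous f) : Integrable f :=
  hf.integrable_of_hasCompactSupport (HasCompactSupport.of_compactSpace f)

lemma integral_E3_apply {f : Torus L → E3} (hf : Integrable f) (i : Fin 3) :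
    (∫ x, f x) i = ∫ x, f x i :=
  ((EuclideanSpace.proj (𝕜 := ℝ) i).integral_comp_comm hf).symm

lemma norm_le_sum (u : E3) : ‖u‖ ≤ |u 0| + |u 1| + |u 2| := by
  have h := norm_sq_eq u
  have h0 := abs_nonneg (u 0)
  have h1 := abs_nonneg (u 1)
  have h2 := abs_nonneg (u 2)
  rw [← sq_abs (u 0), ← sq_abs (u 1), ← sq_abs (u 2)] at h
  refine abs_le_of_sq_le_sq' ?_ (by positivity) |>.2
  nlinarith [mul_nonneg h0 h1, mul_nonneg h0 h2, mul_nonneg h1 h2]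

/-- A mollifier on the torus that is supported away from the origin, at distance comparable
to `ε`. -/
structure IsAnnularKernel (ε A : ℝ) (K : Torus L → ℝ) : Prop where
  smooth : IsSmooth K
  nonneg : ∀ z, 0 ≤ K z
  integral_eq_one : ∫ z, K z = 1
  integral_grad : ∫ z, torusGrad K z = 0
  integral_norm_grad : ∫ z, ‖torusGrad K z‖ ≤ A / ε
  support : ∀ z, K z ≠ 0 ∨ torusGrad K z ≠ 0 → ∃ ℓ : E3, proj L ℓ = z ∧ ε ≤ ‖ℓ‖ ∧ ‖ℓ‖ ≤ 4 * ε

variable (L) in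
-- The kernel is the product of three periodized bumps on [ε, 2ε], so its integrals factor by
-- Fubini. The support lies in a cube in the positive octant, away from the origin; 2ε < L makes the
-- bump fit in one period.
lemma exists_isAnnularKernel : ∃ A : ℝ, 0 ≤ A ∧ ∀ ε : ℝ, 0 < ε → 2 * ε < L →
    ∃ K : Torus L → ℝ, IsAnnularKernel ε A K := by
  obtain ⟨A, hA, H⟩ := exists_scaled_bump
  -- The factor 3 comes from bounding the norm of the gradient by the sum of its three components.
  refine ⟨3 * A, by positivity, fun ε hε hεL => ?_⟩
  obtain ⟨f, hfs, hf0, hf, hf1, hfd, hfA⟩ := H ε hε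
  have hle : ε ≤ 2 * ε := by linarith
  have hf' : ∀ t, t ∉ Icc ε (2 * ε) → deriv f t = 0 :=
    fun t ht => deriv_eq_zero_of_notMem_Icc hf ht
  set κ : AddCircle L → ℝ := AddCircle.liftIco L 0 f with hκ
  set κ' : AddCircle L → ℝ := AddCircle.liftIco L 0 (deriv f) with hκ'
  have hκ0 : ∀ z, 0 ≤ κ z := fun z => hf0 _
  have hκ1 : ∫ z, κ z = 1 := by rw [hκ, integral_liftIco hε hle hεL hf, hf1]
  set K : Torus L → ℝ := fun z => ∏ j, κ (z j) with hK
  have hKs : IsSmooth K := by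
    refine contDiff_prod fun j _ => ?_
    exact (contDiff_liftIco (L := L) hε hle hεL hf hfs).comp
      (EuclideanSpace.proj (𝕜 := ℝ) j).contDiff
  -- Differentiating in direction `i` only replaces the `i`-th factor by its derivative.
  have hpd : ∀ i z, pderiv i K z = ∏ j, (if j = i then κ' else κ) (z j) := by
    intro i z
    obtain ⟨y, rfl⟩ := proj_surjective z
    have e1 : (fun s : ℝ => K (proj L y + proj L (EuclideanSpace.single i s)))
        = fun s : ℝ => κ ((y i + s : ℝ) : AddCircle L)
          * ∏ j ∈ Finset.univ.erase i, κ (proj L y j) := by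
      ext s
      simp only [hK]
      rw [← Finset.mul_prod_erase _ _ (Finset.mem_univ i)]
      congr 1
      · simp [proj]
      · refine Finset.prod_congr rfl fun j hj => ?_
        simp [proj, Finset.ne_of_mem_erase hj]
    have e2 : HasDerivAt (fun s : ℝ => κ ((y i + s : ℝ) : AddCircle L)) (κ' (y i)) 0 := by
      have := hasDerivAt_liftIco (L := L) hε hle hεL hf hfs (y i)
      rw [← add_zero (y i)] at this
      simpa using this.comp_const_add (y i) 0
    unfold pderiv
    rw [e1, (e2.mul_const _).deriv, ← Finset.mul_prod_erase _ _ (Finset.mem_univ i)]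
    congr 1
    · simp [proj]
    · refine Finset.prod_congr rfl fun j hj => ?_
      simp [Finset.ne_of_mem_erase hj]
  have hpd0 : ∀ i, ∫ z, pderiv i K z = 0 := by
    intro i
    simp_rw [hpd]
    rw [integral_fintype_prod_volume_eq_prod
      (f := fun j (w : AddCircle L) => (if j = i then κ' else κ) w)]
    refine Finset.prod_eq_zero (Finset.mem_univ i) ?_
    simp [hκ', integral_liftIco hε hle hεL hf', hfd]
  have hpdA : ∀ i, ∫ z, |pderiv i K z| ≤ A / ε := by
    intro i
    simp_rw [hpd, Finset.abs_prod]
    rw [integral_fintype_prod_volume_eq_prod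
      (f := fun j (w : AddCircle L) => |(if j = i then κ' else κ) w|),
      ← Finset.mul_prod_erase _ _ (Finset.mem_univ i), Finset.prod_eq_one, mul_one]
    · have : (fun w => |κ' w|) = AddCircle.liftIco L 0 (fun t => |deriv f t|) := rfl
      simp only [if_true]
      rw [this, integral_liftIco hε hle hεL]
      · exact hfA
      · intro t ht; simp [hf' t ht]
    · intro j hj
      simp [Finset.ne_of_mem_erase hj, abs_of_nonneg (hκ0 _), hκ1]
  have hgrad := continuous_torusGrad hKs
  refine ⟨K, hKs, fun z => Finset.prod_nonneg fun j _ => hκ0 _, ?_, ?_, ?_, ?_⟩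
  · rw [hK, integral_fintype_prod_volume_eq_prod (f := fun _ => κ)]
    simp [hκ1]
  · ext i
    rw [integral_E3_apply (integrable_of_continuous hgrad)]
    fin_cases i
    exacts [hpd0 0, hpd0 1, hpd0 2]
  · have hi : ∀ i, Integrable (fun z => |pderiv i K z|) := fun i =>
      integrable_of_continuous (hKs.pderiv i).continuous.abs
    calc ∫ z, ‖torusGrad K z‖
        ≤ ∫ z, (|pderiv 0 K z| + |pderiv 1 K z| + |pderiv 2 K z|) := by
          refine integral_mono (integrable_of_continuous hgrad).norm
            (((hi 0).add (hi 1)).add (hi 2)) fun z => norm_le_sum _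
      _ = (∫ z, |pderiv 0 K z|) + (∫ z, |pderiv 1 K z|) + ∫ z, |pderiv 2 K z| := by
          rw [integral_add (f := fun z => |pderiv 0 K z| + |pderiv 1 K z|)
            ((hi 0).add (hi 1)) (hi 2), integral_add (hi 0) (hi 1)]
      _ ≤ A / ε + A / ε + A / ε := by gcongr <;> exact hpdA _
      _ = 3 * A / ε := by ring
  · intro z hz
    have hrep : ∀ j, ∃ y ∈ Icc ε (2 * ε), (y : AddCircle L) = z j := by
      rcases hz with h | h
      · exact fun j => exists_rep_of_liftIco_ne_zero hf
          (Finset.prod_ne_zero_iff.1 h j (Finset.mem_univ j))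
      · have : ∃ i, pderiv i K z ≠ 0 := by
          by_contra! hh
          refine h ?_
          ext i
          fin_cases i <;> simp [torusGrad, hh]
        obtain ⟨i, hi⟩ := this
        rw [hpd] at hi
        intro j
        have hj := Finset.prod_ne_zero_iff.1 hi j (Finset.mem_univ j)
        by_cases hji : j = i
        · rw [if_pos hji] at hj
          exact exists_rep_of_liftIco_ne_zero hf' hj
        · rw [if_neg hji] at hj
          exact exists_rep_of_liftIco_ne_zero hf hj
    choose y hy hyz using hrep
    have hn : ‖(WithLp.toLp 2 y : E3)‖ ^ 2 = y 0 ^ 2 + y 1 ^ 2 + y 2 ^ 2 := norm_sq_eq _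
    -- All three coordinates lie in [ε, 2ε], so the squared norm is between 3ε² and 12ε², within the
    -- required ε² and 16ε².
    have hb : ∀ j, ε ^ 2 ≤ y j ^ 2 ∧ y j ^ 2 ≤ (2 * ε) ^ 2 := fun j =>
      ⟨pow_le_pow_left₀ hε.le (hy j).1 2, pow_le_pow_left₀ (hε.le.trans (hy j).1) (hy j).2 2⟩
    refine ⟨WithLp.toLp 2 y, funext fun j => hyz j, ?_, ?_⟩
    · rw [← sq_le_sq₀ hε.le (norm_nonneg _), hn]
      nlinarith [hb 0, hb 1, hb 2]
    · rw [← sq_le_sq₀ (norm_nonneg _) (by positivity), hn]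
      nlinarith [hb 0, hb 1, hb 2]

end kernel

/-! ### Hölder and Tonelli for products of averages -/

open scoped ENNReal

/-- Hölder's inequality with exponents `9/5, 9/2, 9/2`. -/
lemma lintegral_enorm_mul_mul_le {X : Type*} [MeasurableSpace X] {μ : Measure X} {f g h : X → E3}
    (hf : AEStronglyMeasurable f μ) (hg : AEStronglyMeasurable g μ)
    (hh : AEStronglyMeasurable h μ) :
    ∫⁻ x, ‖f x‖ₑ * (‖g x‖ₑ * ‖h x‖ₑ) ∂μ
      ≤ eLpNorm f (9 / 5) μ * (eLpNorm g (9 / 2) μ * eLpNorm h (9 / 2) μ) := by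
  have e5 : ((9 / 5 : ℝ≥0∞)).toReal = 9 / 5 := by simp
  have e2 : ((9 / 2 : ℝ≥0∞)).toReal = 9 / 2 := by simp
  have t5 : (9 / 5 : ℝ≥0∞) ≠ ⊤ := ENNReal.div_ne_top (by simp) (by simp)
  have t2 : (9 / 2 : ℝ≥0∞) ≠ ⊤ := ENNReal.div_ne_top (by simp) (by simp)
  have z5 : (9 / 5 : ℝ≥0∞) ≠ 0 := by simp
  have z2 : (9 / 2 : ℝ≥0∞) ≠ 0 := by simp
  rw [eLpNorm_eq_lintegral_rpow_enorm_toReal z5 t5, eLpNorm_eq_lintegral_rpow_enorm_toReal z2 t2,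
    eLpNorm_eq_lintegral_rpow_enorm_toReal z2 t2, e5, e2]
  have key := ENNReal.lintegral_prod_norm_pow_le (μ := μ) (Finset.univ : Finset (Fin 3))
    (f := ![fun x => ‖f x‖ₑ ^ (9 / 5 : ℝ), fun x => ‖g x‖ₑ ^ (9 / 2 : ℝ),
      fun x => ‖h x‖ₑ ^ (9 / 2 : ℝ)]) (p := ![5 / 9, 2 / 9, 2 / 9])
    (by
      intro i _
      fin_cases i
      exacts [hf.enorm.pow_const _, hg.enorm.pow_const _, hh.enorm.pow_const _])
    (by simp [Fin.sum_univ_three]; norm_num)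
    (by intro i _; fin_cases i <;> simp <;> norm_num)
  simp only [Fin.prod_univ_three, Matrix.cons_val] at key
  have c1 : ∀ y : ℝ≥0∞, (y ^ (9 / 5 : ℝ)) ^ (5 / 9 : ℝ) = y := fun y => by
    rw [← ENNReal.rpow_mul]; norm_num
  have c2 : ∀ y : ℝ≥0∞, (y ^ (9 / 2 : ℝ)) ^ (2 / 9 : ℝ) = y := fun y => by
    rw [← ENNReal.rpow_mul]; norm_num
  simp only [c1, c2] at key
  have d1 : (1 / (9 / 5) : ℝ) = 5 / 9 := by norm_num
  have d2 : (1 / (9 / 2) : ℝ) = 2 / 9 := by norm_num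
  rw [d1, d2]
  simpa only [mul_assoc] using key

/-- Tonelli's theorem for a product of two averages. -/
lemma lintegral_lintegral_mul_lintegral {X Y Z : Type*} [MeasurableSpace X] [MeasurableSpace Y]
    [MeasurableSpace Z] {μ : Measure X} {ν : Measure Y} {τ : Measure Z} [SFinite μ] [SFinite ν]
    [SFinite τ] {p : X → Y → ℝ≥0∞} {q : X → Z → ℝ≥0∞} (hp : Measurable (Function.uncurry p))
    (hq : Measurable (Function.uncurry q)) :
    ∫⁻ x, (∫⁻ y, p x y ∂ν) * (∫⁻ z, q x z ∂τ) ∂μ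
      = ∫⁻ y, ∫⁻ z, ∫⁻ x, p x y * q x z ∂μ ∂τ ∂ν := by
  have h1 : ∀ x, (∫⁻ y, p x y ∂ν) * (∫⁻ z, q x z ∂τ) = ∫⁻ y, ∫⁻ z, p x y * q x z ∂τ ∂ν := by
    intro x
    have hpx : Measurable (p x) := hp.comp measurable_prodMk_left
    have hqx : Measurable (q x) := hq.comp measurable_prodMk_left
    rw [← lintegral_mul_const _ hpx]
    exact lintegral_congr fun y => (lintegral_const_mul _ hqx).symm
  simp_rw [h1]
  rw [lintegral_lintegral_swap]
  · refine lintegral_congr fun y => ?_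
    rw [lintegral_lintegral_swap]
    exact (Measurable.mul (hp.comp (measurable_fst.prodMk measurable_const)) hq).aemeasurable
  · refine Measurable.aemeasurable ?_
    refine Measurable.lintegral_prod_right
      (f := fun w : X × Y => fun z : Z => p w.1 w.2 * q w.1 z) ?_
    exact (hp.comp measurable_fst).mul
      (hq.comp ((measurable_fst.comp measurable_fst).prodMk measurable_snd))

/-! ### Mollification and the weak curl -/

section convolution

variable {L : ℝ} [Fact (0 < L)]

/-- The average `∫ M(z) f(x + z) dz` with an operator-valued kernel `M`. -/
def average (M : Torus L → E3 →L[ℝ] E3) (f : Torus L → E3) (x : Torus L) : E3 :=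
  ∫ z, M z (f (x + z))

/-- The kernel of the mollification by `K`. -/
def mollKernel (K : Torus L → ℝ) (z : Torus L) : E3 →L[ℝ] E3 :=
  K z • ContinuousLinearMap.id ℝ E3

/-- The kernel of the curl of the mollification by `K`. -/
def curlKernel (K : Torus L → ℝ) (z : Torus L) : E3 →L[ℝ] E3 :=
  crossL.flip (torusGrad K z)

omit [Fact (0 < L)] in
@[simp] lemma mollKernel_apply (K : Torus L → ℝ) (z : Torus L) (v : E3) :
    mollKernel K z v = K z • v := rfl

omit [Fact (0 < L)] in
@[simp] lemma curlKernel_apply (K : Torus L → ℝ) (z : Torus L) (v : E3) :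
    curlKernel K z v = cross v (torusGrad K z) := rfl

omit [Fact (0 < L)] in
lemma continuous_mollKernel {K : Torus L → ℝ} (hK : IsSmooth K) : Continuous (mollKernel K) :=
  hK.continuous.smul continuous_const

omit [Fact (0 < L)] in
lemma continuous_curlKernel {K : Torus L → ℝ} (hK : IsSmooth K) : Continuous (curlKernel K) :=
  crossL.flip.continuous.comp (continuous_torusGrad hK)

lemma average_eq (M : Torus L → E3 →L[ℝ] E3) (f : Torus L → E3) (x : Torus L) :
    average M f x = ∫ y, M (y - x) (f y) := by
  rw [← integral_add_left_eq_self (μ := volume) (fun y => M (y - x) (f y)) x]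
  simp [average]

lemma integrable_kernel_apply {M : Torus L → E3 →L[ℝ] E3} (hM : Continuous M) {f : Torus L → E3}
    (hf : Integrable f) : Integrable (fun z => M z (f z)) := by
  obtain ⟨C, hC0, hC⟩ := exists_bound_of_continuous hM
  refine Integrable.mono' (hf.norm.const_mul C) ?_ (ae_of_all _ fun z => ?_)
  · exact ContinuousLinearMap.aestronglyMeasurable_comp₂ (.id ℝ _) hM.aestronglyMeasurable
      hf.aestronglyMeasurable
  · exact (M z).le_of_opNorm_le (hC z) _

lemma integrable_average_integrand {M : Torus L → E3 →L[ℝ] E3} (hM : Continuous M)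
    {f : Torus L → E3} (hf : Integrable f) (x : Torus L) :
    Integrable (fun z => M z (f (x + z))) :=
  integrable_kernel_apply hM (hf.comp_add_left x)

lemma norm_average_le {M : Torus L → E3 →L[ℝ] E3} {C : ℝ} (hC : ∀ z, ‖M z‖ ≤ C)
    {f : Torus L → E3} (hf : Integrable f) (x : Torus L) :
    ‖average M f x‖ ≤ C * ∫ z, ‖f z‖ := by
  rw [← integral_add_left_eq_self (μ := volume) (fun y => ‖f y‖) x, ← integral_const_mul]
  exact norm_integral_le_of_norm_le ((hf.comp_add_left x).norm.const_mul C)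
    (ae_of_all _ fun z => (M z).le_of_opNorm_le (hC z) _)

lemma stronglyMeasurable_average_param {S : Type*} [MeasurableSpace S]
    {M : Torus L → E3 →L[ℝ] E3} (hM : Continuous M) {f : S → Torus L → E3}
    (hf : Measurable (Function.uncurry f)) :
    StronglyMeasurable (fun p : S × Torus L => average M (f p.1) p.2) := by
  refine StronglyMeasurable.integral_prod_right
    (f := fun p : S × Torus L => fun z => M z (f p.1 (p.2 + z))) ?_
  have h1 : Measurable fun q : (S × Torus L) × Torus L => f q.1.1 (q.1.2 + q.2) :=
    hf.comp ((measurable_fst.comp measurable_fst).prodMk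
      ((measurable_snd.comp measurable_fst).add measurable_snd))
  have h2 : StronglyMeasurable fun q : (S × Torus L) × Torus L => M q.2 :=
    hM.stronglyMeasurable.comp_measurable measurable_snd
  exact (isBoundedBilinearMap_apply (𝕜 := ℝ) (E := E3) (F := E3)).continuous.comp_stronglyMeasurable
    (h2.prodMk h1.stronglyMeasurable)

lemma measurable_average {M : Torus L → E3 →L[ℝ] E3} (hM : Continuous M) {f : Torus L → E3}
    (hf : Measurable f) : Measurable (average M f) :=
  ((stronglyMeasurable_average_param hM (f := fun _ : Unit => f)
    (hf.comp measurable_snd)).measurable).comp (measurable_const (a := ()) |>.prodMk measurable_id)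

/-- The weak curl is tested with the translated kernel times each constant vector `e`, which puts
the derivative on the kernel. -/
lemma IsWeakCurl.average_eq {U J : Torus L → E3} (h : IsWeakCurl U J) (hU : Integrable U)
    (hJ : Integrable J) {K : Torus L → ℝ} (hK : IsSmooth K) (x : Torus L) :
    average (mollKernel K) J x = average (curlKernel K) U x := by
  refine ext_inner_right ℝ fun e => ?_
  have h1 := h (fun y => K (y - x) • e) ((hK.comp_sub_right x).smul_const e)
  have hs : Continuous fun y : Torus L => y - x := continuous_id.sub continuous_const
  have i1 := integrable_kernel_apply ((continuous_mollKernel hK).comp hs) hJ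
  have i2 := integrable_kernel_apply ((continuous_curlKernel hK).comp hs) hU
  simp only [Function.comp_apply] at i1 i2
  rw [EMHD.average_eq, EMHD.average_eq, real_inner_comm, real_inner_comm e,
    ← integral_inner i1, ← integral_inner i2]
  calc _ = ∫ y, inner ℝ (J y) (K (y - x) • e) := by
          refine integral_congr_ae (ae_of_all _ fun y => ?_)
          simp only [mollKernel_apply, inner_smul_right, real_inner_comm]
    _ = _ := h1
    _ = _ := by
          refine integral_congr_ae (ae_of_all _ fun y => ?_)
          simp only [curlKernel_apply]
          rw [curl_smul_const, torusGrad_comp_sub_right, inner_cross_cyclic, real_inner_comm]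

lemma integrable_pairing {M : Torus L → E3 →L[ℝ] E3} (hM : Continuous M) {V F : Torus L → E3}
    (hV : Measurable V) {C : ℝ} (hVC : ∀ x, ‖V x‖ ≤ C) (hF : Integrable F) :
    Integrable (fun p : Torus L × Torus L => inner ℝ (V p.1) (M (p.2 - p.1) (F p.2)))
      (volume.prod volume) := by
  obtain ⟨D, hD0, hD⟩ := exists_bound_of_continuous hM
  have hF2 : Integrable (fun p : Torus L × Torus L => F p.2) (volume.prod volume) := hF.comp_snd _
  have hMp : Continuous fun p : Torus L × Torus L => M (p.2 - p.1) :=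
    hM.comp (continuous_snd.sub continuous_fst)
  refine Integrable.mono' (hF2.norm.const_mul (C * D)) ?_ (ae_of_all _ fun p => ?_)
  · exact (hV.comp measurable_fst).aestronglyMeasurable.inner
      (ContinuousLinearMap.aestronglyMeasurable_comp₂ (.id ℝ _) hMp.aestronglyMeasurable hF2.1)
  · have hC0 : 0 ≤ C := (norm_nonneg _).trans (hVC p.1)
    calc ‖inner ℝ (V p.1) (M (p.2 - p.1) (F p.2))‖
        ≤ ‖V p.1‖ * ‖M (p.2 - p.1) (F p.2)‖ := norm_inner_le_norm _ _
      _ ≤ C * (D * ‖F p.2‖) := by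
          gcongr
          · exact hVC _
          · exact (M _).le_of_opNorm_le (hD _) _
      _ = C * D * ‖F p.2‖ := by ring

lemma integral_inner_average {M : Torus L → E3 →L[ℝ] E3} (hM : Continuous M)
    {V F : Torus L → E3} (hV : Measurable V) {C : ℝ} (hVC : ∀ x, ‖V x‖ ≤ C) (hF : Integrable F) :
    ∫ x, inner ℝ (V x) (average M F x) = ∫ y, ∫ x, inner ℝ (V x) (M (y - x) (F y)) := by
  rw [← integral_integral_swap (integrable_pairing hM hV hVC hF)]
  refine integral_congr_ae (ae_of_all _ fun x => ?_)
  have hs : Continuous fun y : Torus L => y - x := continuous_id.sub continuous_const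
  have i1 := integrable_kernel_apply (hM.comp hs) hF
  simp only [Function.comp_apply] at i1
  simp only
  rw [average_eq, ← integral_inner i1]

/-- Here the outer integral runs over the shift `w`, unlike in `integral_inner_average`. For fixed
`w` the function `F` is merely translated, and the weak curl commutes with translation. -/
lemma integral_inner_average' {M : Torus L → E3 →L[ℝ] E3} (hM : Continuous M)
    {V F : Torus L → E3} (hV : Measurable V) {C : ℝ} (hVC : ∀ x, ‖V x‖ ≤ C) (hF : Integrable F) :
    ∫ x, inner ℝ (V x) (average M F x) = ∫ w, ∫ x, inner ℝ (V x) (M w (F (x + w))) := by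
  have h0 := (measurePreserving_prod_add (volume : Measure (Torus L))
    (volume : Measure (Torus L))).integrable_comp_of_integrable (integrable_pairing hM hV hVC hF)
  simp only [Function.comp_def, add_sub_cancel_left] at h0
  rw [← integral_integral_swap h0]
  refine integral_congr_ae (ae_of_all _ fun x => ?_)
  simp only
  rw [average, ← integral_inner (integrable_average_integrand hM hF x)]

/-- The curl of a mollification is the mollification of the curl. -/
lemma IsWeakCurl.integral_average {U J : Torus L → E3} (h : IsWeakCurl U J) (hU : Integrable U)
    (hJ : Integrable J) {K : Torus L → ℝ} (hK : IsSmooth K) (e : E3) (y : Torus L) :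
    ∫ x, inner ℝ (K (y - x) • e) (average (mollKernel K) J x)
      = ∫ x, inner ℝ (cross e (torusGrad K (y - x))) (average (mollKernel K) U x) := by
  have hs : Continuous fun x : Torus L => y - x := continuous_const.sub continuous_id
  have c1 : Continuous fun x : Torus L => K (y - x) • e :=
    (hK.continuous.comp hs).smul continuous_const
  have c2 : Continuous fun x : Torus L => cross e (torusGrad K (y - x)) :=
    continuous_cross.comp (continuous_const.prodMk ((continuous_torusGrad hK).comp hs))
  obtain ⟨C₁, -, hC₁⟩ := exists_bound_of_continuous c1
  obtain ⟨C₂, -, hC₂⟩ := exists_bound_of_continuous c2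
  rw [integral_inner_average' (continuous_mollKernel hK) c1.measurable hC₁ hJ,
    integral_inner_average' (continuous_mollKernel hK) c2.measurable hC₂ hU]
  refine integral_congr_ae (ae_of_all _ fun w => ?_)
  simp only [mollKernel_apply, inner_smul_right]
  rw [integral_const_mul, integral_const_mul]
  congr 1
  -- The test function is centred at `y + w`, so that translating both sides by `w` gives the kernel
  -- at `y - x` paired with the shifted fields.
  have h1 := h (fun x => K (y + w - x) • e) ((hK.comp_const_sub (y + w)).smul_const e)
  rw [← integral_add_right_eq_self _ w,
    ← integral_add_right_eq_self (fun x => inner ℝ (U x) _) w] at h1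
  simp only [add_sub_add_right_eq_sub, curl_smul_const, torusGrad_comp_const_sub] at h1
  simp_rw [real_inner_comm] at h1 ⊢
  rw [h1]
  refine integral_congr_ae (ae_of_all _ fun x => ?_)
  simp only
  simp [inner_eq, cross]
  ring

/-- The energy flux through a mollification. -/
lemma IsWeakCurl.integral_inner_curl_average {U J F : Torus L → E3} (h : IsWeakCurl U J)
    (hU : Integrable U) (hJ : Integrable J) (hF : Integrable F) (hUm : Measurable U)
    (hJm : Measurable J) {K : Torus L → ℝ} (hK : IsSmooth K) :
    ∫ x, inner ℝ (average (mollKernel K) U x) (average (curlKernel K) F x)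
      = ∫ x, inner ℝ (average (mollKernel K) J x) (average (mollKernel K) F x) := by
  have hM := continuous_mollKernel hK
  obtain ⟨C, -, hC⟩ := exists_bound_of_continuous hM
  rw [integral_inner_average (continuous_curlKernel hK) (measurable_average hM hUm)
      (norm_average_le hC hU) hF,
    integral_inner_average hM (measurable_average hM hJm) (norm_average_le hC hJ) hF]
  refine integral_congr_ae (ae_of_all _ fun y => ?_)
  -- For fixed `y` the value `F y` is a constant vector, so `IsWeakCurl.integral_average` applies
  -- with `e := F y`.
  have := h.integral_average hU hJ hK (F y) y
  simp only [curlKernel_apply, mollKernel_apply]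
  simp_rw [real_inner_comm] at this ⊢
  exact this.symm

end convolution

lemma enorm_cross_le (u v : E3) : ‖cross u v‖ₑ ≤ ‖u‖ₑ * ‖v‖ₑ := by
  rw [← ofReal_norm, ← ofReal_norm, ← ofReal_norm, ← ENNReal.ofReal_mul (norm_nonneg _)]
  exact ENNReal.ofReal_le_ofReal (norm_cross_le u v)

lemma enorm_inner_le (u v : E3) : ‖inner ℝ u v‖ₑ ≤ ‖u‖ₑ * ‖v‖ₑ := by
  rw [← ofReal_norm, ← ofReal_norm, ← ofReal_norm, ← ENNReal.ofReal_mul (norm_nonneg _)]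
  exact ENNReal.ofReal_le_ofReal (norm_inner_le_norm u v)

/-- By Tonelli the `x`-integral is done first, for fixed `y` and `z`. The bound is required only
where both weights are nonzero, which later confines the shifts to the annulus. -/
lemma lintegral_mul_le_of_forall_le {X Y Z : Type*} [MeasurableSpace X] [MeasurableSpace Y]
    [MeasurableSpace Z] {μ : Measure X} {ν : Measure Y} {τ : Measure Z} [SFinite μ] [SFinite ν]
    [SFinite τ] {k : Y → ℝ≥0∞} {g : Z → ℝ≥0∞} {p : X → Y → ℝ≥0∞} {q : X → Z → ℝ≥0∞}
    (hk : Measurable k) (hg : Measurable g) (hp : Measurable (Function.uncurry p))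
    (hq : Measurable (Function.uncurry q)) {c : ℝ≥0∞}
    (h : ∀ y z, k y ≠ 0 → g z ≠ 0 → ∫⁻ x, p x y * q x z ∂μ ≤ c) :
    ∫⁻ x, (∫⁻ y, k y * p x y ∂ν) * (∫⁻ z, g z * q x z ∂τ) ∂μ
      ≤ (∫⁻ y, k y ∂ν) * ((∫⁻ z, g z ∂τ) * c) := by
  have m1 : Measurable (Function.uncurry fun x y => k y * p x y) :=
    (hk.comp measurable_snd).mul hp
  have m2 : Measurable (Function.uncurry fun x z => g z * q x z) :=
    (hg.comp measurable_snd).mul hq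
  rw [lintegral_lintegral_mul_lintegral m1 m2, ← lintegral_mul_const _ hg,
    ← lintegral_mul_const _ hk]
  refine lintegral_mono fun y => ?_
  rw [← lintegral_const_mul _ (hg.mul_const c)]
  refine lintegral_mono fun z => ?_
  by_cases hy : k y = 0
  · simp [hy]
  by_cases hz : g z = 0
  · simp [hz]
  have e : ∀ x, k y * p x y * (g z * q x z) = k y * g z * (p x y * q x z) := fun x => by ring
  have m3 : Measurable fun x => p x y * q x z :=
    (hp.comp measurable_prodMk_right).mul (hq.comp measurable_prodMk_right)
  simp_rw [e]
  rw [lintegral_const_mul _ m3, mul_assoc]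
  exact mul_le_mul' le_rfl (mul_le_mul' le_rfl (h y z hy hz))

/-! ### Commutator estimate for the energy flux -/

section commutator

variable {L : ℝ} [Fact (0 < L)]

lemma mollKernel_average_sub {K : Torus L → ℝ} (hK : IsSmooth K) (h1 : ∫ z, K z = 1)
    {f : Torus L → E3} (hf : Integrable f) (x : Torus L) :
    average (mollKernel K) f x - f x = ∫ z, K z • (f (x + z) - f x) := by
  have i1 := integrable_average_integrand (continuous_mollKernel hK) hf x
  have i2 : Integrable (fun z => K z • f x) :=
    (integrable_of_continuous hK.continuous).smul_const _
  simp_rw [smul_sub]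
  rw [integral_sub (f := fun z => K z • f (x + z)) i1 i2, integral_smul_const, h1, one_smul]
  rfl

lemma enorm_mollKernel_average_sub_le {K : Torus L → ℝ} (hK : IsSmooth K) (h1 : ∫ z, K z = 1)
    {f : Torus L → E3} (hf : Integrable f) (x : Torus L) :
    ‖average (mollKernel K) f x - f x‖ₑ ≤ ∫⁻ z, ‖K z‖ₑ * ‖f (x + z) - f x‖ₑ := by
  rw [mollKernel_average_sub hK h1 hf]
  refine (enorm_integral_le_lintegral_enorm _).trans_eq ?_
  simp_rw [enorm_smul]

/-- The gradient of the kernel has mean zero, so the constant `f x` may be subtracted and only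
increments remain. -/
lemma enorm_curlKernel_average_le {K : Torus L → ℝ} (hK : IsSmooth K)
    (h0 : ∫ z, torusGrad K z = 0) {f : Torus L → E3} (hf : Integrable f) (x : Torus L) :
    ‖average (curlKernel K) f x‖ₑ ≤ ∫⁻ z, ‖torusGrad K z‖ₑ * ‖f (x + z) - f x‖ₑ := by
  have i1 := integrable_average_integrand (continuous_curlKernel hK) hf x
  have hg := integrable_of_continuous (continuous_torusGrad hK)
  have i2 : Integrable (fun z => crossL (f x) (torusGrad K z)) :=
    (crossL (f x)).integrable_comp hg
  have e1 : average (curlKernel K) f x = ∫ z, cross (f (x + z) - f x) (torusGrad K z) := by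
    have h2 : ∀ z, cross (f (x + z) - f x) (torusGrad K z)
        = curlKernel K z (f (x + z)) - crossL (f x) (torusGrad K z) := by
      intro z
      rw [curlKernel_apply, ← crossL_apply, ← crossL_apply, map_sub]
      rfl
    simp_rw [h2]
    rw [integral_sub i1 i2, ContinuousLinearMap.integral_comp_comm _ hg, h0, map_zero, sub_zero]
    rfl
  rw [e1]
  refine (enorm_integral_le_lintegral_enorm _).trans (lintegral_mono fun z => ?_)
  rw [mul_comm]
  exact enorm_cross_le _ _

/-- The Constantin-E-Titi commutator identity. -/
lemma average_cross_sub {K : Torus L → ℝ} (hK : IsSmooth K) (h1 : ∫ z, K z = 1)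
    {U J : Torus L → E3} (hU : Integrable U) (hJ : Integrable J)
    (hF : Integrable fun x => cross (J x) (U x)) (x : Torus L) :
    average (mollKernel K) (fun x => cross (J x) (U x)) x
        - cross (average (mollKernel K) J x) (average (mollKernel K) U x)
      = (∫ z, K z • cross (J (x + z) - J x) (U (x + z) - U x))
        - cross (average (mollKernel K) J x - J x) (average (mollKernel K) U x - U x) := by
  have hM := continuous_mollKernel hK
  have i1 := integrable_average_integrand hM hF x
  have i2 := integrable_average_integrand hM hJ x
  have i3 := integrable_average_integrand hM hU x
  have i4 : Integrable (fun z => K z • cross (J x) (U x)) :=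
    (integrable_of_continuous hK.continuous).smul_const _
  have j2 := (crossL.flip (U x)).integrable_comp i2
  have j3 := (crossL (J x)).integrable_comp i3
  have h2 : ∀ z, K z • cross (J (x + z) - J x) (U (x + z) - U x)
      = mollKernel K z (cross (J (x + z)) (U (x + z)))
        - crossL.flip (U x) (mollKernel K z (J (x + z)))
        - crossL (J x) (mollKernel K z (U (x + z))) + K z • cross (J x) (U x) := by
    intro z
    rw [cross_sub_sub, mollKernel_apply, mollKernel_apply, mollKernel_apply, map_smul, map_smul]
    simp only [ContinuousLinearMap.flip_apply, crossL_apply, smul_add, smul_sub]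
  simp_rw [h2]
  rw [integral_add (f := fun z => mollKernel K z (cross (J (x + z)) (U (x + z)))
        - crossL.flip (U x) (mollKernel K z (J (x + z)))
        - crossL (J x) (mollKernel K z (U (x + z)))) ((i1.sub j2).sub j3) i4,
    integral_sub (f := fun z => mollKernel K z (cross (J (x + z)) (U (x + z)))
        - crossL.flip (U x) (mollKernel K z (J (x + z)))) (i1.sub j2) j3, integral_sub i1 j2,
    ContinuousLinearMap.integral_comp_comm _ i2, ContinuousLinearMap.integral_comp_comm _ i3,
    integral_smul_const, h1, one_smul, cross_sub_sub]
  simp only [ContinuousLinearMap.flip_apply, crossL_apply, average]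
  abel

lemma lintegral_enorm_eq_one {ε A : ℝ} {K : Torus L → ℝ} (hK : IsAnnularKernel ε A K) :
    ∫⁻ z, ‖K z‖ₑ = 1 := by
  rw [← ofReal_integral_norm_eq_lintegral_enorm (integrable_of_continuous hK.smooth.continuous)]
  simp_rw [Real.norm_of_nonneg (hK.nonneg _)]
  simp [hK.integral_eq_one]

lemma lintegral_enorm_grad_le {ε A : ℝ} {K : Torus L → ℝ} (hK : IsAnnularKernel ε A K) :
    ∫⁻ z, ‖torusGrad K z‖ₑ ≤ ENNReal.ofReal (A / ε) := by
  rw [← ofReal_integral_norm_eq_lintegral_enorm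
    (integrable_of_continuous (continuous_torusGrad hK.smooth))]
  exact ENNReal.ofReal_le_ofReal hK.integral_norm_grad

/-- Orthogonality of j_ε and j_ε × b_ε allows the mollified nonlinearity to be replaced by the
commutator. Writing the other j_ε as a curl of b_ε leaves one increment of the current and two of
the field, as Hölder's inequality requires. -/
lemma enorm_flux_density_le {ε A₀ : ℝ} {K : Torus L → ℝ} (hK : IsAnnularKernel ε A₀ K)
    {U J : Torus L → E3} (hcurl : IsWeakCurl U J) (hU : Integrable U) (hJ : Integrable J)
    (hF : Integrable fun x => cross (J x) (U x)) (x : Torus L) :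
    ‖inner ℝ (average (mollKernel K) J x)
        (average (mollKernel K) (fun x => cross (J x) (U x)) x)‖ₑ
      ≤ ((∫⁻ z, ‖K z‖ₑ * (‖J (x + z) - J x‖ₑ * ‖U (x + z) - U x‖ₑ))
        + (∫⁻ z, ‖K z‖ₑ * ‖J (x + z) - J x‖ₑ) * ∫⁻ z, ‖K z‖ₑ * ‖U (x + z) - U x‖ₑ)
        * ∫⁻ w, ‖torusGrad K w‖ₑ * ‖U (x + w) - U x‖ₑ := by
  have e1 : inner ℝ (average (mollKernel K) J x)
      (average (mollKernel K) (fun x => cross (J x) (U x)) x)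
      = inner ℝ (average (mollKernel K) (fun x => cross (J x) (U x)) x
        - cross (average (mollKernel K) J x) (average (mollKernel K) U x))
          (average (mollKernel K) J x) := by
    rw [inner_sub_left, inner_cross_self_left, sub_zero, real_inner_comm]
  rw [e1]
  refine (enorm_inner_le _ _).trans (mul_le_mul' ?_ ?_)
  · rw [average_cross_sub hK.smooth hK.integral_eq_one hU hJ hF]
    refine (enorm_sub_le).trans (add_le_add ?_ ?_)
    · refine (enorm_integral_le_lintegral_enorm _).trans (lintegral_mono fun z => ?_)
      rw [enorm_smul]
      exact mul_le_mul' le_rfl (enorm_cross_le _ _)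
    · refine (enorm_cross_le _ _).trans ?_
      exact mul_le_mul' (enorm_mollKernel_average_sub_le hK.smooth hK.integral_eq_one hJ x)
        (enorm_mollKernel_average_sub_le hK.smooth hK.integral_eq_one hU x)
  · rw [hcurl.average_eq hU hJ hK.smooth]
    exact enorm_curlKernel_average_le hK.smooth hK.integral_grad hU x

/-- Integrating products of three weighted averages. -/
lemma lintegral_flux_le {X : Type*} [MeasurableSpace X] {μ : Measure X} [SFinite μ]
    {k g : X → ℝ≥0∞} {p q : X → X → ℝ≥0∞} (hk : Measurable k) (hg : Measurable g)
    (hp : Measurable (Function.uncurry p)) (hq : Measurable (Function.uncurry q)) {c G : ℝ≥0∞}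
    (hone : ∫⁻ z, k z ∂μ = 1) (hG : ∫⁻ z, g z ∂μ ≤ G)
    (h : ∀ z v w, k z ≠ 0 → k v ≠ 0 → g w ≠ 0 → ∫⁻ x, p x z * (q x v * q x w) ∂μ ≤ c) :
    ∫⁻ x, ((∫⁻ z, k z * (p x z * q x z) ∂μ)
        + (∫⁻ z, k z * p x z ∂μ) * ∫⁻ z, k z * q x z ∂μ) * (∫⁻ w, g w * q x w ∂μ) ∂μ
      ≤ 2 * (c * G) := by
  have m1 : Measurable (Function.uncurry fun x z => p x z * q x z) := hp.mul hq
  have m3 : Measurable (Function.uncurry fun (x : X) (v : X × X) => p x v.1 * q x v.2) :=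
    (hp.comp (measurable_fst.prodMk (measurable_fst.comp measurable_snd))).mul
      (hq.comp (measurable_fst.prodMk (measurable_snd.comp measurable_snd)))
  have mkk : Measurable fun v : X × X => k v.1 * k v.2 :=
    (hk.comp measurable_fst).mul (hk.comp measurable_snd)
  -- The product of two averages becomes one average over pairs of shifts, so the bilinear Tonelli
  -- bound covers the triple product.
  have e2 : ∀ x, (∫⁻ z, k z * p x z ∂μ) * ∫⁻ z, k z * q x z ∂μ
      = ∫⁻ v : X × X, k v.1 * k v.2 * (p x v.1 * q x v.2) ∂(μ.prod μ) := by
    intro x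
    have hpx : Measurable (p x) := hp.comp measurable_prodMk_left
    have hqx : Measurable (q x) := hq.comp measurable_prodMk_left
    rw [← lintegral_prod_mul (f := fun z => k z * p x z) (g := fun z => k z * q x z)
      (hk.mul hpx).aemeasurable (hk.mul hqx).aemeasurable]
    exact lintegral_congr fun v => by ring
  have n1 : Measurable fun x => ∫⁻ z, k z * (p x z * q x z) ∂μ :=
    Measurable.lintegral_prod_right' (f := fun v : X × X => k v.2 * (p v.1 v.2 * q v.1 v.2))
      ((hk.comp measurable_snd).mul m1)
  have n2 : Measurable fun x => ∫⁻ w, g w * q x w ∂μ :=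
    Measurable.lintegral_prod_right' (f := fun v : X × X => g v.2 * q v.1 v.2)
      ((hg.comp measurable_snd).mul hq)
  have b1 := lintegral_mul_le_of_forall_le (μ := μ) (ν := μ) (τ := μ) (c := c) hk hg m1 hq
    fun z w hz hw => by simpa only [mul_assoc] using h z z w hz hz hw
  have b2 := lintegral_mul_le_of_forall_le (μ := μ) (ν := μ.prod μ) (τ := μ) (c := c) mkk hg m3 hq
    fun v w hv hw => by
      simpa only [mul_assoc] using
        h v.1 v.2 w (left_ne_zero_of_mul hv) (right_ne_zero_of_mul hv) hw
  rw [lintegral_prod_mul hk.aemeasurable hk.aemeasurable] at b2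
  rw [hone, one_mul] at b1 b2
  rw [one_mul] at b2
  simp_rw [e2, add_mul]
  rw [lintegral_add_left (f := fun x => (∫⁻ z, k z * (p x z * q x z) ∂μ) * ∫⁻ w, g w * q x w ∂μ)
    (n1.mul n2), two_mul, mul_comm c G]
  exact add_le_add (b1.trans (mul_le_mul' hG le_rfl)) (b2.trans (mul_le_mul' hG le_rfl))

/-- The estimate of the energy flux by the increments of the magnetic field and of the current. -/
lemma enorm_flux_le {ε A₀ : ℝ} {K : Torus L → ℝ} (hK : IsAnnularKernel ε A₀ K)
    {U J : Torus L → E3} (hcurl : IsWeakCurl U J) (hU : Integrable U) (hJ : Integrable J)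
    (hUm : Measurable U) (hJm : Measurable J)
    (hF : Integrable fun x => cross (J x) (U x)) {A B : ℝ≥0∞}
    (hA : ∀ z, K z ≠ 0 ∨ torusGrad K z ≠ 0 →
      eLpNorm (fun x => J (x + z) - J x) (9 / 5) volume ≤ A)
    (hB : ∀ z, K z ≠ 0 ∨ torusGrad K z ≠ 0 →
      eLpNorm (fun x => U (x + z) - U x) (9 / 2) volume ≤ B) :
    ‖∫ x, inner ℝ (average (mollKernel K) J x)
        (average (mollKernel K) (fun x => cross (J x) (U x)) x)‖ₑ
      ≤ 2 * (A * (B * B) * ENNReal.ofReal (A₀ / ε)) := by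
  have mdJ : Measurable (Function.uncurry fun x z => ‖J (x + z) - J x‖ₑ) :=
    ((hJm.comp (measurable_fst.add measurable_snd)).sub (hJm.comp measurable_fst)).enorm
  have mdU : Measurable (Function.uncurry fun x z => ‖U (x + z) - U x‖ₑ) :=
    ((hUm.comp (measurable_fst.add measurable_snd)).sub (hUm.comp measurable_fst)).enorm
  have aJ : ∀ z, AEStronglyMeasurable (fun x => J (x + z) - J x) volume := fun z =>
    ((hJm.comp (measurable_id.add_const z)).sub hJm).aestronglyMeasurable
  have aU : ∀ z, AEStronglyMeasurable (fun x => U (x + z) - U x) volume := fun z =>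
    ((hUm.comp (measurable_id.add_const z)).sub hUm).aestronglyMeasurable
  refine (enorm_integral_le_lintegral_enorm _).trans
    ((lintegral_mono fun x => enorm_flux_density_le hK hcurl hU hJ hF x).trans ?_)
  refine lintegral_flux_le (c := A * (B * B)) hK.smooth.continuous.measurable.enorm
    (continuous_torusGrad hK.smooth).measurable.enorm mdJ mdU (lintegral_enorm_eq_one hK)
    (lintegral_enorm_grad_le hK) fun z v w hz hv hw => ?_
  rw [enorm_ne_zero] at hz hv hw
  -- The three shifts are independent: `z` and `v` come from the kernel, `w` from its gradient.
  exact (lintegral_enorm_mul_mul_le (aJ z) (aU v) (aU w)).trans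
    (mul_le_mul' (hA z (.inl hz)) (mul_le_mul' (hB v (.inl hv)) (hB w (.inr hw))))

end commutator

/-! ### Convergence of mollifications in L² -/

section convergence

variable {L : ℝ} [Fact (0 < L)]

/-- This is continuity of the translation action on L², evaluated at the identity. -/
lemma tendsto_eLpNorm_translate_sub {U : Torus L → E3} (hU : MemLp U 2) :
    Tendsto (fun z : Torus L => eLpNorm (fun x => U (x + z) - U x) 2 volume) (𝓝 0) (𝓝 0) := by
  have : Fact ((2 : ℝ≥0∞) ≠ ⊤) := ⟨by simp⟩
  have : ContinuousVAdd (Torus L)ᵈᵃᵃ (Lp E3 2 (volume : Measure (Torus L))) :=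
    Lp.instContinuousVAddDomAddAct
  have hc : Continuous fun z : Torus L => DomAddAct.mk z +ᵥ hU.toLp U :=
    (DomAddAct.continuous_mk).vadd continuous_const
  have h1 := (hc.edist continuous_const).tendsto (f := fun z => edist _ (hU.toLp U)) 0
  have h2 : DomAddAct.mk (0 : Torus L) +ᵥ hU.toLp U = hU.toLp U := by simp
  rw [h2, edist_self] at h1
  refine h1.congr fun z => ?_
  rw [DomAddAct.mk_vadd_toLp, Lp.edist_toLp_toLp]
  congr 1
  ext x
  simp [add_comm]

lemma lintegral_enorm_mul_le_two {X : Type*} [MeasurableSpace X] {μ : Measure X} {f g : X → E3}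
    (hf : AEStronglyMeasurable f μ) (hg : AEStronglyMeasurable g μ) :
    ∫⁻ x, ‖f x‖ₑ * ‖g x‖ₑ ∂μ ≤ eLpNorm f 2 μ * eLpNorm g 2 μ := by
  have := ENNReal.lintegral_mul_le_Lp_mul_Lq μ Real.HolderConjugate.two_two hf.enorm hg.enorm
  rw [eLpNorm_eq_lintegral_rpow_enorm_toReal (by simp) (by simp),
    eLpNorm_eq_lintegral_rpow_enorm_toReal (by simp) (by simp)]
  simpa using this

lemma eLpNorm_two_sq {X : Type*} [MeasurableSpace X] {μ : Measure X} (f : X → E3) :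
    eLpNorm f 2 μ ^ 2 = ∫⁻ x, ‖f x‖ₑ * ‖f x‖ₑ ∂μ := by
  rw [eLpNorm_eq_lintegral_rpow_enorm_toReal (by simp) (by simp), ← ENNReal.rpow_natCast,
    ← ENNReal.rpow_mul]
  simp [pow_two]

/-- A form of Minkowski's integral inequality. The square is opened into a double average over
shifts, and Cauchy-Schwarz is applied for each pair. -/
lemma eLpNorm_average_sub_le {ε A₀ : ℝ} {K : Torus L → ℝ} (hK : IsAnnularKernel ε A₀ K)
    {U : Torus L → E3} (hU : Integrable U) (hUm : Measurable U) {D : ℝ≥0∞}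
    (hD : ∀ z, K z ≠ 0 → eLpNorm (fun x => U (x + z) - U x) 2 volume ≤ D) :
    eLpNorm (fun x => average (mollKernel K) U x - U x) 2 volume ≤ D := by
  have mk := hK.smooth.continuous.measurable.enorm
  have mdU : Measurable (Function.uncurry fun x z => ‖U (x + z) - U x‖ₑ) :=
    ((hUm.comp (measurable_fst.add measurable_snd)).sub (hUm.comp measurable_fst)).enorm
  have aU : ∀ z, AEStronglyMeasurable (fun x => U (x + z) - U x) volume := fun z =>
    ((hUm.comp (measurable_id.add_const z)).sub hUm).aestronglyMeasurable
  rw [← ENNReal.pow_le_pow_left_iff (two_ne_zero), eLpNorm_two_sq]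
  calc ∫⁻ x, ‖average (mollKernel K) U x - U x‖ₑ * ‖average (mollKernel K) U x - U x‖ₑ
      ≤ ∫⁻ x, (∫⁻ z, ‖K z‖ₑ * ‖U (x + z) - U x‖ₑ) * (∫⁻ z, ‖K z‖ₑ * ‖U (x + z) - U x‖ₑ) :=
        lintegral_mono fun x => by
          have := enorm_mollKernel_average_sub_le hK.smooth hK.integral_eq_one hU x
          exact mul_le_mul' this this
    _ ≤ (∫⁻ z, ‖K z‖ₑ) * ((∫⁻ z, ‖K z‖ₑ) * (D * D)) := by
        refine lintegral_mul_le_of_forall_le mk mk mdU mdU fun z w hz hw => ?_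
        rw [enorm_ne_zero] at hz hw
        exact (lintegral_enorm_mul_le_two (aU z) (aU w)).trans (mul_le_mul' (hD z hz) (hD w hw))
    _ = D ^ 2 := by rw [lintegral_enorm_eq_one hK, one_mul, one_mul, pow_two]

lemma integral_norm_sq_eq {X : Type*} [MeasurableSpace X] {μ : Measure X} {f : X → E3}
    (hf : AEStronglyMeasurable f μ) : ∫ x, ‖f x‖ ^ 2 ∂μ = (eLpNorm f 2 μ).toReal ^ 2 := by
  rw [← ENNReal.toReal_pow, eLpNorm_two_sq,
    integral_eq_lintegral_of_nonneg_ae (f := fun x => ‖f x‖ ^ 2) (ae_of_all _ fun x => by positivity) (hf.norm.pow 2)]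
  congr 1
  refine lintegral_congr fun x => ?_
  rw [pow_two, ENNReal.ofReal_mul (norm_nonneg _), ofReal_norm]

lemma eLpNorm_translate_sub_le {U : Torus L → E3} (hU : MemLp U 2) (z : Torus L) :
    eLpNorm (fun x => U (x + z) - U x) 2 volume ≤ 2 * eLpNorm U 2 volume := by
  have mp := measurePreserving_add_right (volume : Measure (Torus L)) z
  have h1 : eLpNorm (fun x => U (x + z)) 2 volume = eLpNorm U 2 volume :=
    eLpNorm_comp_measurePreserving hU.1 mp
  have h2 := eLpNorm_sub_le (p := 2) (hU.1.comp_measurePreserving mp) hU.1 (by norm_num)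
  rw [two_mul]
  refine h2.trans_eq ?_
  rw [← h1]
  rfl

lemma integral_norm_sq_average_le {ε A₀ : ℝ} {K : Torus L → ℝ} (hK : IsAnnularKernel ε A₀ K)
    {U : Torus L → E3} (hU : MemLp U 2) (hUm : Measurable U) {M : ℝ} (hM : 0 ≤ M)
    (hUM : eLpNorm U 2 volume ≤ ENNReal.ofReal M) :
    ∫ x, ‖average (mollKernel K) U x‖ ^ 2 ≤ (3 * M) ^ 2 := by
  have hUi := hU.integrable (by norm_num)
  have ma := measurable_average (continuous_mollKernel hK.smooth) hUm
  rw [integral_norm_sq_eq ma.aestronglyMeasurable]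
  gcongr
  refine ENNReal.toReal_le_of_le_ofReal (by positivity) ?_
  -- The constant 3 is crude: 2 for the difference between the average and `U`, and 1 for `U`
  -- itself. Only uniformity in the kernel matters.
  have h1 := eLpNorm_average_sub_le hK hUi hUm (D := 2 * eLpNorm U 2 volume)
    fun z _ => eLpNorm_translate_sub_le hU z
  have h2 := eLpNorm_add_le (p := 2) (ma.sub hUm).aestronglyMeasurable hU.1 (by norm_num)
  have e : (average (mollKernel K) U - U) + U = average (mollKernel K) U := sub_add_cancel _ _
  rw [e] at h2
  refine h2.trans ((add_le_add h1 le_rfl).trans ?_)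
  calc 2 * eLpNorm U 2 volume + eLpNorm U 2 volume = 3 * eLpNorm U 2 volume := by ring
    _ ≤ 3 * ENNReal.ofReal M := by gcongr
    _ = ENNReal.ofReal (3 * M) := by
        rw [ENNReal.ofReal_mul (by norm_num)]; simp

/-- Mollifications converge in energy. -/
lemma tendsto_integral_norm_sq_average {A₀ : ℝ} {ε : ℕ → ℝ} (hε : Tendsto ε atTop (𝓝 0))
    {K : ℕ → Torus L → ℝ} (hK : ∀ n, IsAnnularKernel (ε n) A₀ (K n)) {U : Torus L → E3}
    (hU : MemLp U 2) (hUm : Measurable U) :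
    Tendsto (fun n => ∫ x, ‖average (mollKernel (K n)) U x‖ ^ 2) atTop (𝓝 (∫ x, ‖U x‖ ^ 2)) := by
  have hUi := hU.integrable (by norm_num)
  have ma := fun n => measurable_average (continuous_mollKernel (hK n).smooth) hUm
  have hp : Tendsto (fun ℓ : E3 => eLpNorm (fun x => U (x + proj L ℓ) - U x) 2 volume)
      (𝓝 0) (𝓝 0) := by
    have h0 : proj L 0 = 0 := by ext i; simp [proj]
    refine (tendsto_eLpNorm_translate_sub hU).comp ?_
    rw [← h0]
    exact continuous_proj.tendsto 0
  have h1 : Tendsto (fun n => eLpNorm (average (mollKernel (K n)) U - U) 2 volume)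
      atTop (𝓝 0) := by
    rw [ENNReal.tendsto_nhds_zero]
    intro D hD
    rw [ENNReal.tendsto_nhds_zero] at hp
    obtain ⟨δ, hδ, hball⟩ := Metric.eventually_nhds_iff.1 (hp D hD)
    have h4 : Tendsto (fun n => 4 * ε n) atTop (𝓝 0) := by simpa using hε.const_mul 4
    filter_upwards [h4.eventually (gt_mem_nhds hδ)] with n hn
    refine eLpNorm_average_sub_le (hK n) hUi hUm fun z hz => ?_
    obtain ⟨ℓ, rfl, -, hℓ⟩ := (hK n).support z (.inl hz)
    exact hball (by rw [dist_zero_right]; linarith)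
  have mem : ∀ n, MemLp (average (mollKernel (K n)) U) 2 := by
    intro n
    obtain ⟨C, -, hC⟩ := exists_bound_of_continuous (continuous_mollKernel (hK n).smooth)
    exact MemLp.of_bound (ma n).aestronglyMeasurable _ (ae_of_all _ (norm_average_le hC hUi))
  have h2 : Tendsto (fun n => (mem n).toLp _) atTop (𝓝 (hU.toLp U)) := by
    rw [tendsto_iff_edist_tendsto_0]
    simpa only [Lp.edist_toLp_toLp] using h1
  have h3 := (h2.norm).pow 2
  simp only [Lp.norm_toLp] at h3
  rw [integral_norm_sq_eq hU.1]
  exact h3.congr fun n => (integral_norm_sq_eq (mem n).1).symm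

end convergence

/-! ### Evolution and energy balance of the mollified field -/

section evolution

variable {L : ℝ} [Fact (0 < L)]

lemma integrable_kernel_apply_prod {τ : Measure ℝ} [SFinite τ] {M : Torus L → E3 →L[ℝ] E3}
    (hM : Continuous M) {f : ℝ → Torus L → E3}
    (hf : Integrable (fun p : ℝ × Torus L => f p.1 p.2) (τ.prod volume)) (x : Torus L) :
    Integrable (fun p : ℝ × Torus L => M (p.2 - x) (f p.1 p.2)) (τ.prod volume) := by
  obtain ⟨C, hC0, hC⟩ := exists_bound_of_continuous hM
  have hMp : Continuous fun p : ℝ × Torus L => M (p.2 - x) :=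
    hM.comp (continuous_snd.sub continuous_const)
  refine Integrable.mono' (hf.norm.const_mul C) ?_
    (ae_of_all _ fun p => (M _).le_of_opNorm_le (hC _) _)
  exact ContinuousLinearMap.aestronglyMeasurable_comp₂ (.id ℝ _) hMp.aestronglyMeasurable hf.1

lemma integrable_average_time {τ : Measure ℝ} [SFinite τ] {M : Torus L → E3 →L[ℝ] E3}
    (hM : Continuous M) {f : ℝ → Torus L → E3}
    (hf : Integrable (fun p : ℝ × Torus L => f p.1 p.2) (τ.prod volume)) (x : Torus L) :
    Integrable (fun t => average M (f t) x) τ := by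
  simp_rw [average_eq]
  exact (integrable_kernel_apply_prod hM hf x).integral_prod_left

lemma integrable_apply {X : Type*} [MeasurableSpace X] {μ : Measure X} {f : X → E3}
    (hf : Integrable f μ) (i : Fin 3) : Integrable (fun x => f x i) μ :=
  (EuclideanSpace.proj (𝕜 := ℝ) i).integrable_comp hf

/-- This Fubini step turns space-time pairings from the weak formulation into time integrals of
mollified fields at a fixed point. -/
lemma integral_mul_average_time {τ : Measure ℝ} [SFinite τ] {M : Torus L → E3 →L[ℝ] E3}
    (hM : Continuous M) {f : ℝ → Torus L → E3}
    (hf : Integrable (fun p : ℝ × Torus L => f p.1 p.2) (τ.prod volume)) (x : Torus L)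
    {η : ℝ → ℝ} (hη : Continuous η) {C : ℝ} (hC : ∀ t, ‖η t‖ ≤ C) (i : Fin 3) :
    Integrable (fun p : ℝ × Torus L => η p.1 * M (p.2 - x) (f p.1 p.2) i) (τ.prod volume) ∧
    ∫ p, η p.1 * M (p.2 - x) (f p.1 p.2) i ∂(τ.prod volume)
      = ∫ t, average M (f t) x i * η t ∂τ := by
  have h1 := integrable_apply (integrable_kernel_apply_prod hM hf x) i
  have h2 : Integrable (fun p : ℝ × Torus L => η p.1 * M (p.2 - x) (f p.1 p.2) i)
      (τ.prod volume) :=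
    h1.bdd_mul (hη.comp continuous_fst).aestronglyMeasurable (ae_of_all _ fun p => hC p.1)
  refine ⟨h2, ?_⟩
  rw [integral_prod _ h2]
  refine integral_congr_ae ?_
  filter_upwards [hf.prod_right_ae] with t ht
  have hs : Continuous fun y : Torus L => y - x := continuous_id.sub continuous_const
  have i1 : Integrable fun y => M (y - x) (f t y) := integrable_kernel_apply (hM.comp hs) ht
  rw [integral_const_mul, average_eq, integral_E3_apply i1, mul_comm]

variable {T : ℝ} {b j : ℝ → Torus L → E3}

lemma IsWeakSolution.exists_bound (hb : IsWeakSolution T b j) :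
    ∃ M : ℝ, 0 ≤ M ∧ ∀ᵐ t ∂(volume.restrict (Ioo 0 T)),
      MemLp (b t) 2 volume ∧ eLpNorm (b t) 2 volume ≤ ENNReal.ofReal M := by
  obtain ⟨M, hM⟩ := hb.finite_energy
  refine ⟨max M 0, le_max_right _ _, ?_⟩
  filter_upwards [hM] with t ht
  exact ⟨ht.1, ht.2.trans (ENNReal.ofReal_le_ofReal (le_max_left _ _))⟩

lemma IsWeakSolution.exists_lintegral_bound (hb : IsWeakSolution T b j) :
    ∃ M : ℝ, 0 ≤ M ∧ ∀ᵐ t ∂(volume.restrict (Ioo 0 T)),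
      ∫⁻ x, ‖b t x‖ₑ ≤ ENNReal.ofReal M := by
  obtain ⟨M, hM0, hM⟩ := hb.exists_bound
  set V : ℝ≥0∞ := (volume (univ : Set (Torus L))) ^ (1 / (1 : ℝ≥0∞).toReal - 1 / (2 : ℝ≥0∞).toReal)
    with hV
  have hVt : V ≠ ⊤ := by
    refine ENNReal.rpow_ne_top_of_nonneg ?_ (measure_ne_top _ _)
    norm_num
  refine ⟨M * V.toReal, by positivity, ?_⟩
  filter_upwards [hM] with t ht
  rw [← eLpNorm_one_eq_lintegral_enorm, ENNReal.ofReal_mul hM0, ENNReal.ofReal_toReal hVt]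
  exact (eLpNorm_le_eLpNorm_mul_rpow_measure_univ (by norm_num) ht.1.1).trans
    (mul_le_mul' ht.2 le_rfl)

lemma IsWeakSolution.integrable_b (hb : IsWeakSolution T b j) :
    Integrable (fun p : ℝ × Torus L => b p.1 p.2) (spaceTime L T) := by
  refine ⟨hb.measurable_b, ?_⟩
  obtain ⟨M, hM0, hM⟩ := hb.exists_lintegral_bound
  unfold HasFiniteIntegral spaceTime
  rw [lintegral_prod _ hb.measurable_b.enorm]
  refine (lintegral_mono_ae hM).trans_lt ?_
  rw [lintegral_const]
  exact ENNReal.mul_lt_top ENNReal.ofReal_lt_top (measure_lt_top _ _)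

lemma prod_restrict_univ (s : Set ℝ) : (volume.restrict s).prod (volume : Measure (Torus L))
    = (volume.prod volume).restrict (s ×ˢ univ) := by
  rw [← Measure.prod_restrict, Measure.restrict_univ]

lemma spaceTime_mono {a c : ℝ} (ha : 0 ≤ a) (hc : c ≤ T) :
    (volume.restrict (Ioo a c)).prod (volume : Measure (Torus L)) ≤ spaceTime L T := by
  unfold spaceTime
  rw [prod_restrict_univ, prod_restrict_univ]
  exact Measure.restrict_mono (Set.prod_mono (Ioo_subset_Ioo ha hc) le_rfl) le_rfl

/-- The nonlinearity is only locally integrable in time, so the interval must stay away from 0 and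
`T`; the torus is compact. -/
lemma IsWeakSolution.integrable_nonlin (hb : IsWeakSolution T b j) {a c : ℝ} (ha : 0 < a)
    (hc : c < T) : Integrable (fun p : ℝ × Torus L => cross (j p.1 p.2) (b p.1 p.2))
      ((volume.restrict (Ioo a c)).prod volume) := by
  have h1 := hb.integrable_nonlinearity.integrableOn_compact_subset (t := Icc a c ×ˢ univ)
    (Set.prod_mono (fun t ht => ⟨ha.trans_le ht.1, ht.2.trans_lt hc⟩) le_rfl)
    (isCompact_Icc.prod isCompact_univ)
  rw [prod_restrict_univ]
  exact h1.mono_set (Set.prod_mono Ioo_subset_Icc_self le_rfl)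

/-- The magnetic field, mollified in space, evolves by the curl of the mollified nonlinearity. -/
lemma IsWeakSolution.isWeakNegDeriv_average (hb : IsWeakSolution T b j) {a c : ℝ} (ha : 0 < a)
    (hc : c < T) {K : Torus L → ℝ} (hK : IsSmooth K) (x : Torus L) (i : Fin 3) :
    IsWeakNegDeriv a c (fun t => average (mollKernel K) (b t) x i)
      (fun t => average (curlKernel K) (fun y => cross (j t y) (b t y)) x i) := by
  intro θ hθ
  obtain ⟨C, -, hC, hC'⟩ := hθ.exists_bound
  have hbi := hb.integrable_b.mono_measure (spaceTime_mono (L := L) ha.le hc.le)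
  obtain ⟨i1, e1⟩ := integral_mul_average_time (continuous_mollKernel hK) hbi x
    hθ.continuous_deriv hC' i
  obtain ⟨i2, e2⟩ := integral_mul_average_time (continuous_curlKernel hK)
    (f := fun t y => cross (j t y) (b t y)) (hb.integrable_nonlin ha hc) x
    hθ.smooth.continuous hC i
  rw [← e1, ← e2, ← sub_eq_zero, ← integral_sub i1 i2]
  set e : E3 := EuclideanSpace.single i (1 : ℝ) with he
  have hinner : ∀ v : E3, inner ℝ v e = v i := fun v => by
    simp [he, EuclideanSpace.inner_single_right]
  -- The equation is tested with a time bump times the kernel centred at `x`, in the `i`-th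
  -- coordinate direction.
  set Φ : ℝ → Torus L → E3 := fun t y => (θ t * K (y - x)) • e with hΦ
  have hΦd : ∀ t y, deriv (fun s => Φ s y) t = (deriv θ t * K (y - x)) • e := by
    intro t y
    have h1 := (hθ.smooth.differentiable (by simp) t).hasDerivAt
    exact ((h1.mul_const (K (y - x))).smul_const e).deriv
  have hΦc : ∀ t y, curl (Φ t) y = cross (θ t • torusGrad K (y - x)) e := by
    intro t y
    rw [hΦ, curl_smul_const, torusGrad_const_mul (fun y => K (y - x)), torusGrad_comp_sub_right]
  have hΦt : IsTestField T Φ := by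
    obtain ⟨a', c', h1, h2, h3⟩ := hθ.support
    refine ⟨?_, a', c', ha.trans h1, h2.trans hc, fun t ht y => by simp [hΦ, h3 t ht]⟩
    have h4 : ContDiff ℝ ∞ fun p : ℝ × E3 => θ p.1 := hθ.smooth.comp contDiff_fst
    have h5 : ContDiff ℝ ∞ fun p : ℝ × E3 => K (proj L p.2 - x) :=
      ContDiff.comp (g := fun y => K (proj L y - x)) (hK.comp_sub_right x) contDiff_snd
    exact (h4.mul h5).smul contDiff_const
  have h0 := hb.equation Φ hΦt
  have hpt : ∀ p : ℝ × Torus L, inner ℝ (b p.1 p.2) (deriv (fun s => Φ s p.2) p.1)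
        - inner ℝ (cross (j p.1 p.2) (b p.1 p.2)) (curl (Φ p.1) p.2)
      = deriv θ p.1 * mollKernel K (p.2 - x) (b p.1 p.2) i
        - θ p.1 * curlKernel K (p.2 - x) (cross (j p.1 p.2) (b p.1 p.2)) i := by
    intro p
    rw [hΦd, hΦc, inner_smul_right, hinner, inner_cross_cyclic, hinner, mollKernel_apply,
      curlKernel_apply, ← crossL_apply _ (θ p.1 • _), map_smul]
    simp only [PiLp.smul_apply, smul_eq_mul, crossL_apply]
    ring
  simp_rw [hpt] at h0
  rw [← h0]
  unfold spaceTime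
  rw [prod_restrict_univ, prod_restrict_univ]
  refine (setIntegral_eq_of_subset_of_forall_sdiff_eq_zero
    (measurableSet_Ioo.prod MeasurableSet.univ)
    (Set.prod_mono (Ioo_subset_Ioo ha.le hc.le) le_rfl) fun p hp => ?_).symm
  have hp1 : p.1 ∉ Ioo a c := fun h => hp.2 ⟨h, mem_univ _⟩
  obtain ⟨a', c', h1, h2, h3⟩ := hθ.support
  have hp2 : p.1 ∉ Icc a' c' := fun h => hp1 ⟨h1.trans_le h.1, h.2.trans_lt h2⟩
  rw [h3 _ hp2, deriv_eq_zero_of_notMem_Icc h3 hp2]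
  simp

/-- The energy equality for the mollified magnetic field. -/
lemma IsWeakSolution.integral_norm_sq_average (hb : IsWeakSolution T b j)
    (hbm : Measurable (Function.uncurry b)) (hjm : Measurable (Function.uncurry j))
    {a c : ℝ} (ha : 0 < a) (hac : a < c) (hc : c < T) {K : Torus L → ℝ} (hK : IsSmooth K)
    {θ : ℝ → ℝ} (hθ : IsTimeTest a c θ) :
    ∫ t in Ioo a c, (∫ x, ‖average (mollKernel K) (b t) x‖ ^ 2) * deriv θ t
      = 2 * ∫ t in Ioo a c, (∫ x, inner ℝ (average (mollKernel K) (j t) x)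
          (average (mollKernel K) (fun y => cross (j t y) (b t y)) x)) * θ t := by
  obtain ⟨C, hC0, hC, hC'⟩ := hθ.exists_bound
  set F : ℝ → Torus L → E3 := fun t y => cross (j t y) (b t y) with hF
  have hFm : Measurable (Function.uncurry F) := continuous_cross.measurable.comp (hjm.prodMk hbm)
  set τ : Measure ℝ := volume.restrict (Ioo a c) with hτ
  have hτle : τ ≤ volume.restrict (Ioo 0 T) :=
    Measure.restrict_mono (Ioo_subset_Ioo ha.le hc.le) le_rfl
  have hFi : Integrable (fun p : ℝ × Torus L => F p.1 p.2) (τ.prod volume) :=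
    hb.integrable_nonlin ha hc
  have hbi : Integrable (fun p : ℝ × Torus L => b p.1 p.2) (τ.prod volume) :=
    hb.integrable_b.mono_measure (spaceTime_mono ha.le hc.le)
  set g : ℝ → Torus L → E3 := fun t x => average (mollKernel K) (b t) x with hg
  set h : ℝ → Torus L → E3 := fun t x => average (curlKernel K) (F t) x with hh
  have gm : Measurable fun p : ℝ × Torus L => g p.1 p.2 :=
    (stronglyMeasurable_average_param (continuous_mollKernel hK) hbm).measurable
  have hm : Measurable fun p : ℝ × Torus L => h p.1 p.2 :=
    (stronglyMeasurable_average_param (continuous_curlKernel hK) hFm).measurable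
  obtain ⟨D, hD0, hD⟩ := exists_bound_of_continuous (continuous_mollKernel hK)
  obtain ⟨D', hD0', hD'⟩ := exists_bound_of_continuous (continuous_curlKernel hK)
  obtain ⟨M, hM0, hM⟩ := hb.exists_lintegral_bound
  -- The mollified field is bounded uniformly in time and space, while its time derivative is
  -- bounded in space by an integrable function of time. Their product is therefore integrable.
  have hgb : ∀ᵐ t ∂τ, ∀ x, ‖g t x‖ ≤ D * M := by
    filter_upwards [ae_mono hτle hM, hbi.prod_right_ae] with t ht hti x
    refine (norm_average_le hD hti x).trans ?_
    gcongr
    rw [integral_norm_eq_lintegral_enorm hti.1]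
    exact ENNReal.toReal_le_of_le_ofReal hM0 ht
  have hhb : ∀ᵐ t ∂τ, ∀ x, ‖h t x‖ ≤ D' * ∫ y, ‖F t y‖ := by
    filter_upwards [hFi.prod_right_ae] with t hti x
    exact norm_average_le hD' hti x
  have hgb' : ∀ᵐ p ∂(τ.prod (volume : Measure (Torus L))), ‖g p.1 p.2‖ ≤ D * M := by
    filter_upwards [Measure.quasiMeasurePreserving_fst.ae hgb] with p hp using hp _
  have hhb' : ∀ᵐ p ∂(τ.prod (volume : Measure (Torus L))),
      ‖h p.1 p.2‖ ≤ D' * ∫ y, ‖F p.1 y‖ := by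
    filter_upwards [Measure.quasiMeasurePreserving_fst.ae hhb] with p hp using hp _
  have hhi : Integrable (fun p : ℝ × Torus L => h p.1 p.2) (τ.prod volume) :=
    Integrable.mono' ((hFi.norm.integral_prod_left.const_mul D').comp_fst _)
      hm.aestronglyMeasurable hhb'
  have coord : ∀ (v : E3) (i : Fin 3), ‖v i‖ ≤ ‖v‖ := fun v i => PiLp.norm_apply_le v i
  have mi : ∀ i : Fin 3, Measurable fun v : E3 => v i := fun i =>
    (EuclideanSpace.proj (𝕜 := ℝ) i).continuous.measurable
  have I1 : ∀ i, Integrable (fun p : ℝ × Torus L => g p.1 p.2 i ^ 2 * deriv θ p.1)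
      (τ.prod volume) := by
    intro i
    refine Integrable.mono' (integrable_const ((D * M) ^ 2 * C)) ?_ ?_
    · exact ((((mi i).comp gm).pow_const 2).mul
        (hθ.continuous_deriv.measurable.comp measurable_fst)).aestronglyMeasurable
    · filter_upwards [hgb'] with p hp
      rw [norm_mul, norm_pow]
      gcongr
      · exact (coord _ i).trans hp
      · exact hC' _
  have I2 : ∀ i, Integrable (fun p : ℝ × Torus L => 2 * (g p.1 p.2 i * h p.1 p.2 i) * θ p.1)
      (τ.prod volume) := by
    intro i
    refine Integrable.mono' (hhi.norm.const_mul (2 * (D * M) * C)) ?_ ?_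
    · exact ((((mi i).comp gm).mul ((mi i).comp hm)).const_mul 2 |>.mul
        (hθ.smooth.continuous.measurable.comp measurable_fst)).aestronglyMeasurable
    · filter_upwards [hgb'] with p hp
      rw [norm_mul, norm_mul, norm_mul, Real.norm_ofNat]
      calc 2 * (‖g p.1 p.2 i‖ * ‖h p.1 p.2 i‖) * ‖θ p.1‖
          ≤ 2 * ((D * M) * ‖h p.1 p.2‖) * C := by
            gcongr
            · exact (coord _ i).trans hp
            · exact coord _ i
            · exact hC _
        _ = 2 * (D * M) * C * ‖h p.1 p.2‖ := by ring
  -- With space as the outer variable, the scalar product rule in time applies at every fixed `x`.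
  have key : ∀ i, ∫ p, g p.1 p.2 i ^ 2 * deriv θ p.1 ∂(τ.prod (volume : Measure (Torus L)))
      = ∫ p, 2 * (g p.1 p.2 i * h p.1 p.2 i) * θ p.1 ∂(τ.prod (volume : Measure (Torus L))) := by
    intro i
    rw [integral_prod_symm _ (I1 i), integral_prod_symm _ (I2 i)]
    refine integral_congr_ae (ae_of_all _ fun x => ?_)
    exact IsWeakNegDeriv.sq hac
      (integrable_apply (integrable_average_time (continuous_mollKernel hK) hbi x) i)
      (integrable_apply (integrable_average_time (continuous_curlKernel hK) hFi x) i)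
      (hb.isWeakNegDeriv_average ha hc hK x i) θ hθ
  have S1 : ∫ p, ‖g p.1 p.2‖ ^ 2 * deriv θ p.1 ∂(τ.prod (volume : Measure (Torus L)))
      = ∑ i, ∫ p, g p.1 p.2 i ^ 2 * deriv θ p.1 ∂(τ.prod (volume : Measure (Torus L))) := by
    rw [← integral_finsetSum _ fun i _ => I1 i]
    refine integral_congr_ae (ae_of_all _ fun p => ?_)
    simp only [norm_sq_eq, Fin.sum_univ_three]
    ring
  have S2 : ∫ p, 2 * inner ℝ (g p.1 p.2) (h p.1 p.2) * θ p.1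
        ∂(τ.prod (volume : Measure (Torus L)))
      = ∑ i, ∫ p, 2 * (g p.1 p.2 i * h p.1 p.2 i) * θ p.1
        ∂(τ.prod (volume : Measure (Torus L))) := by
    rw [← integral_finsetSum _ fun i _ => I2 i]
    refine integral_congr_ae (ae_of_all _ fun p => ?_)
    simp only [inner_eq, Fin.sum_univ_three]
    ring
  have J1 : Integrable (fun p : ℝ × Torus L => ‖g p.1 p.2‖ ^ 2 * deriv θ p.1)
      (τ.prod volume) := by
    refine (integrable_finsetSum Finset.univ fun i _ => I1 i).congr (ae_of_all _ fun p => ?_)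
    simp only [norm_sq_eq, Fin.sum_univ_three]
    ring
  have J2 : Integrable (fun p : ℝ × Torus L => 2 * inner ℝ (g p.1 p.2) (h p.1 p.2) * θ p.1)
      (τ.prod volume) := by
    refine (integrable_finsetSum Finset.univ fun i _ => I2 i).congr (ae_of_all _ fun p => ?_)
    simp only [inner_eq, Fin.sum_univ_three]
    ring
  have main := S1.trans ((Finset.sum_congr rfl fun i _ => key i).trans S2.symm)
  rw [integral_prod _ J1, integral_prod _ J2] at main
  simp_rw [integral_mul_const, integral_const_mul] at main
  rw [main, ← integral_const_mul]
  refine integral_congr_ae ?_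
  filter_upwards [hbi.prod_right_ae, hFi.prod_right_ae, ae_mono hτle hb.current] with t h1 h2 h3
  -- The curl passes from the mollified nonlinearity to the mollified field, where it produces the
  -- mollified current.
  have := h3.2.integral_inner_curl_average h1 h3.1 h2 (hbm.comp measurable_prodMk_left)
    (hjm.comp measurable_prodMk_left) hK
  simp only [hg, hh]
  rw [this]
  ring

end evolution

/-! ### Smallness of the moduli and Young's inequality -/

section modulus

/-- Only the product `s₁ ^ 2 * s₂` has to be small, so one vanishing modulus suffices: the other is
bounded by `S`. The limits are punctured, hence the exclusion of ℓ = 0. -/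
lemma exists_modulus {σ₁ σ₂ : E3 → ℝ} {ρ K : ℝ} (hρ : 0 < ρ)
    (hσ₁ : ∀ ℓ, ‖ℓ‖ < ρ → 0 ≤ σ₁ ℓ ∧ σ₁ ℓ ≤ K) (hσ₂ : ∀ ℓ, ‖ℓ‖ < ρ → 0 ≤ σ₂ ℓ ∧ σ₂ ℓ ≤ K)
    (hσ : Tendsto σ₁ (𝓝[≠] 0) (𝓝 0) ∨ Tendsto σ₂ (𝓝[≠] 0) (𝓝 0)) {η : ℝ} (hη : 0 < η) :
    ∃ s₁ s₂ δ : ℝ, 0 ≤ s₁ ∧ 0 ≤ s₂ ∧ 0 < δ ∧ δ ≤ ρ ∧ s₁ ^ 2 * s₂ ≤ η ∧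
      ∀ ℓ : E3, ℓ ≠ 0 → ‖ℓ‖ < δ → σ₁ ℓ ^ (1 / 3 : ℝ) ≤ s₁ ∧ σ₂ ℓ ^ (1 / 3 : ℝ) ≤ s₂ := by
  have hK : 0 ≤ K := (hσ₁ 0 (by simpa using hρ)).1.trans (hσ₁ 0 (by simpa using hρ)).2
  set S := K ^ (1 / 3 : ℝ) with hS
  have hS0 : 0 ≤ S := by positivity
  have small : ∀ {σ : E3 → ℝ}, (∀ ℓ, ‖ℓ‖ < ρ → 0 ≤ σ ℓ ∧ σ ℓ ≤ K) →
      Tendsto σ (𝓝[≠] 0) (𝓝 0) → ∀ γ : ℝ, 0 < γ →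
      ∃ δ, 0 < δ ∧ δ ≤ ρ ∧ ∀ ℓ : E3, ℓ ≠ 0 → ‖ℓ‖ < δ → σ ℓ ^ (1 / 3 : ℝ) ≤ γ := by
    intro σ hs ht γ hγ
    have h1 := ht.eventually (gt_mem_nhds (show (0 : ℝ) < γ ^ 3 by positivity))
    rw [eventually_nhdsWithin_iff, Metric.eventually_nhds_iff] at h1
    obtain ⟨δ, hδ, h2⟩ := h1
    refine ⟨min δ ρ, lt_min hδ hρ, min_le_right _ _, fun ℓ h0 hℓ => ?_⟩
    have h3 := h2 (by rw [dist_zero_right]; exact hℓ.trans_le (min_le_left _ _)) h0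
    have h4 := (hs ℓ (hℓ.trans_le (min_le_right _ _))).1
    calc σ ℓ ^ (1 / 3 : ℝ) ≤ (γ ^ 3) ^ (1 / 3 : ℝ) :=
          Real.rpow_le_rpow h4 h3.le (by norm_num)
      _ = γ := by
          rw [← Real.rpow_natCast, ← Real.rpow_mul hγ.le]; norm_num
  have big : ∀ {σ : E3 → ℝ}, (∀ ℓ, ‖ℓ‖ < ρ → 0 ≤ σ ℓ ∧ σ ℓ ≤ K) →
      ∀ ℓ : E3, ‖ℓ‖ < ρ → σ ℓ ^ (1 / 3 : ℝ) ≤ S := fun hs ℓ hℓ =>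
    Real.rpow_le_rpow (hs ℓ hℓ).1 (hs ℓ hℓ).2 (by norm_num)
  rcases hσ with h | h
  · obtain ⟨δ, hδ, hδρ, H⟩ := small hσ₁ h (Real.sqrt (η / (S + 1))) (by positivity)
    refine ⟨_, S, δ, Real.sqrt_nonneg _, hS0, hδ, hδρ, ?_, fun ℓ h0 hℓ =>
      ⟨H ℓ h0 hℓ, big hσ₂ ℓ (hℓ.trans_le hδρ)⟩⟩
    rw [Real.sq_sqrt (by positivity), div_mul_eq_mul_div, div_le_iff₀ (by positivity)]
    nlinarith
  · obtain ⟨δ, hδ, hδρ, H⟩ := small hσ₂ h (η / (S ^ 2 + 1)) (by positivity)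
    refine ⟨S, _, δ, hS0, by positivity, hδ, hδρ, ?_, fun ℓ h0 hℓ =>
      ⟨big hσ₁ ℓ (hℓ.trans_le hδρ), H ℓ h0 hℓ⟩⟩
    rw [mul_div_assoc', div_le_iff₀ (by positivity)]
    nlinarith

/-- The ratio `x / ε` lies in [1, 4], so its power is at most `4 ^ |α|` whatever the sign of the
exponent. -/
lemma rpow_le_of_mem_annulus {ε x α : ℝ} (hε : 0 < ε) (h1 : ε ≤ x) (h2 : x ≤ 4 * ε) :
    x ^ α ≤ 4 ^ |α| * ε ^ α := by
  have hx : 0 < x := hε.trans_le h1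
  have h3 : 1 ≤ x / ε := (one_le_div hε).2 h1
  have h4 : x / ε ≤ 4 := (div_le_iff₀ hε).2 h2
  calc x ^ α = (x / ε) ^ α * ε ^ α := by
        rw [← Real.mul_rpow (by positivity) hε.le, div_mul_cancel₀ _ hε.ne']
    _ ≤ 4 ^ |α| * ε ^ α := by
        gcongr
        exact (Real.rpow_le_rpow_of_exponent_le h3 (le_abs_self α)).trans
          (Real.rpow_le_rpow (by positivity) h4 (abs_nonneg _))

/-- Weighted AM-GM with weights 2/r₁ and 1/r₂. It dominates the time factor of the flux by an
integrable function. -/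
lemma sq_rpow_mul_rpow_le {r₁ r₂ x y : ℝ} (hr₁ : 1 < r₁) (hr₂ : 1 < r₂)
    (hr : 2 / r₁ + 1 / r₂ = 1) (hx : 0 ≤ x) (hy : 0 ≤ y) :
    (x ^ (1 / r₁)) ^ 2 * y ^ (1 / r₂) ≤ 2 / r₁ * x + 1 / r₂ * y := by
  rw [← Real.rpow_natCast, ← Real.rpow_mul hx]
  have : 1 / r₁ * ((2 : ℕ) : ℝ) = 2 / r₁ := by push_cast; ring
  rw [this]
  exact Real.geom_mean_le_arith_mean2_weighted (by positivity) (by positivity) hx hy hr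

end modulus

/-! ### Conservation of the energy -/

section conservation

variable {L : ℝ} [Fact (0 < L)] {T : ℝ} {b j b' j' : ℝ → Torus L → E3}

lemma IsWeakCurl.congr {U J U' J' : Torus L → E3} (h : IsWeakCurl U J) (hU : U =ᵐ[volume] U')
    (hJ : J =ᵐ[volume] J') : IsWeakCurl U' J' := by
  intro φ hφ
  have h1 : ∫ x, inner ℝ (J' x) (φ x) = ∫ x, inner ℝ (J x) (φ x) := by
    refine integral_congr_ae ?_
    filter_upwards [hJ] with x hx
    rw [hx]
  have h2 : ∫ x, inner ℝ (U' x) (curl φ x) = ∫ x, inner ℝ (U x) (curl φ x) := by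
    refine integral_congr_ae ?_
    filter_upwards [hU] with x hx
    rw [hx]
  rw [h1, h2, h φ hφ]

lemma IsWeakSolution.congr (h : IsWeakSolution T b j)
    (hb : ∀ᵐ p ∂(spaceTime L T), b p.1 p.2 = b' p.1 p.2)
    (hj : ∀ᵐ p ∂(spaceTime L T), j p.1 p.2 = j' p.1 p.2) : IsWeakSolution T b' j' := by
  have hbt : ∀ᵐ t ∂(volume.restrict (Ioo 0 T)), b t =ᵐ[volume] b' t := Measure.ae_ae_of_ae_prod hb
  have hjt : ∀ᵐ t ∂(volume.restrict (Ioo 0 T)), j t =ᵐ[volume] j' t := Measure.ae_ae_of_ae_prod hj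
  refine ⟨h.measurable_b.congr hb, h.measurable_j.congr hj, ?_, ?_, ?_, ?_, ?_⟩
  · obtain ⟨M, hM⟩ := h.finite_energy
    refine ⟨M, ?_⟩
    filter_upwards [hM, hbt] with t h1 h2
    exact ⟨h1.1.ae_eq h2, (eLpNorm_congr_ae h2.symm).trans_le h1.2⟩
  · filter_upwards [h.div_free, hbt] with t h1 h2
    intro ψ hψ
    rw [← h1 ψ hψ]
    refine integral_congr_ae ?_
    filter_upwards [h2] with x hx
    rw [hx]
  · filter_upwards [h.current, hbt, hjt] with t h1 h2 h3
    exact ⟨h1.1.congr h3, h1.2.congr h2 h3⟩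
  · intro p hp
    obtain ⟨u, hu, hui⟩ := h.integrable_nonlinearity p hp
    refine ⟨u ∩ (Ioo 0 T ×ˢ univ), inter_mem hu self_mem_nhdsWithin, ?_⟩
    refine (hui.mono_set inter_subset_left).congr ?_
    have h4 : ∀ᵐ p ∂(volume.restrict (Ioo 0 T ×ˢ (univ : Set (Torus L)))),
        cross (j p.1 p.2) (b p.1 p.2) = cross (j' p.1 p.2) (b' p.1 p.2) := by
      have e : spaceTime L T = volume.restrict (Ioo 0 T ×ˢ (univ : Set (Torus L))) :=
        prod_restrict_univ _
      rw [← e]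
      filter_upwards [hb, hj] with p h1 h2
      rw [h1, h2]
    exact ae_restrict_of_ae_restrict_of_subset inter_subset_right h4
  · intro Φ hΦ
    rw [← h.equation Φ hΦ]
    refine integral_congr_ae ?_
    filter_upwards [hb, hj] with p h1 h2
    rw [h1, h2]

/-- The energy flux through scale `ε`, bounded by the moduli of continuity. -/
lemma norm_flux_le {ε A₀ : ℝ} (hε : 0 < ε) (hε1 : ε ≤ 1) (hA₀ : 0 ≤ A₀) {K : Torus L → ℝ}
    (hK : IsAnnularKernel ε A₀ K)
    {U J : Torus L → E3} (hcurl : IsWeakCurl U J) (hU : Integrable U) (hJ : Integrable J)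
    (hUm : Measurable U) (hJm : Measurable J)
    (hF : Integrable fun x => cross (J x) (U x)) {α β c₁ c₂ s₁ s₂ : ℝ} (hαβ : 1 ≤ 2 * α + β)
    (hc₁ : 0 ≤ c₁) (hc₂ : 0 ≤ c₂) (hs₁ : 0 ≤ s₁) (hs₂ : 0 ≤ s₂)
    (hUi : ∀ ℓ : E3, ε ≤ ‖ℓ‖ → ‖ℓ‖ ≤ 4 * ε →
      eLpNorm (incr U ℓ) (9 / 2) volume ≤ ENNReal.ofReal (c₁ * ‖ℓ‖ ^ α * s₁))
    (hJi : ∀ ℓ : E3, ε ≤ ‖ℓ‖ → ‖ℓ‖ ≤ 4 * ε →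
      eLpNorm (incr J ℓ) (9 / 5) volume ≤ ENNReal.ofReal (c₂ * ‖ℓ‖ ^ β * s₂)) :
    ‖∫ x, inner ℝ (average (mollKernel K) J x)
        (average (mollKernel K) (fun x => cross (J x) (U x)) x)‖
      ≤ 2 * A₀ * (4 ^ |β| * (4 ^ |α|) ^ 2) * (s₁ ^ 2 * s₂) * (c₁ ^ 2 * c₂) := by
  have hA : ∀ z, K z ≠ 0 ∨ torusGrad K z ≠ 0 → eLpNorm (fun x => J (x + z) - J x) (9 / 5) volume
      ≤ ENNReal.ofReal (c₂ * (4 ^ |β| * ε ^ β) * s₂) := by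
    intro z hz
    obtain ⟨ℓ, rfl, h1, h2⟩ := hK.support z hz
    refine (hJi ℓ h1 h2).trans (ENNReal.ofReal_le_ofReal ?_)
    gcongr
    exact rpow_le_of_mem_annulus hε h1 h2
  have hB : ∀ z, K z ≠ 0 ∨ torusGrad K z ≠ 0 → eLpNorm (fun x => U (x + z) - U x) (9 / 2) volume
      ≤ ENNReal.ofReal (c₁ * (4 ^ |α| * ε ^ α) * s₁) := by
    intro z hz
    obtain ⟨ℓ, rfl, h1, h2⟩ := hK.support z hz
    refine (hUi ℓ h1 h2).trans (ENNReal.ofReal_le_ofReal ?_)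
    gcongr
    exact rpow_le_of_mem_annulus hε h1 h2
  have h := enorm_flux_le hK hcurl hU hJ hUm hJm hF hA hB
  have two : ∀ y : ℝ, 2 * ENNReal.ofReal y = ENNReal.ofReal (2 * y) := fun y => by
    rw [ENNReal.ofReal_mul (by norm_num)]
    simp
  rw [← ENNReal.ofReal_mul (by positivity), ← ENNReal.ofReal_mul (by positivity),
    ← ENNReal.ofReal_mul (by positivity), two, ← ofReal_norm, ENNReal.ofReal_le_ofReal_iff (by positivity)] at h
  refine h.trans ?_
  -- The scaling condition 2α + β ≥ 1 with ε ≤ 1 absorbs the factor 1/ε from the gradient of the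
  -- kernel.
  have hpow : ε ^ β * (ε ^ α * ε ^ α) / ε ≤ 1 := by
    rw [div_le_one hε, ← Real.rpow_add hε, ← Real.rpow_add hε]
    calc ε ^ (β + (α + α)) ≤ ε ^ (1 : ℝ) :=
          Real.rpow_le_rpow_of_exponent_ge hε hε1 (by linarith)
      _ = ε := Real.rpow_one ε
  calc _ = 2 * A₀ * (4 ^ |β| * (4 ^ |α|) ^ 2) * (s₁ ^ 2 * s₂) * (c₁ ^ 2 * c₂)
        * (ε ^ β * (ε ^ α * ε ^ α) / ε) := by ring
    _ ≤ _ := mul_le_of_le_one_right (by positivity) hpow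

/-- The energy balance at scale `ε n` passes to the limit by dominated convergence. A flux bound
independent of `n` therefore survives for the energy itself. -/
lemma abs_integral_energy_mul_deriv_le (hb : IsWeakSolution T b j)
    (hbm : Measurable (Function.uncurry b)) (hjm : Measurable (Function.uncurry j))
    {a c : ℝ} (ha : 0 < a) (hac : a < c) (hc : c < T) {A₀ : ℝ}
    {ε : ℕ → ℝ} (hε : Tendsto ε atTop (𝓝 0)) {K : ℕ → Torus L → ℝ}
    (hK : ∀ n, IsAnnularKernel (ε n) A₀ (K n)) {q : ℝ → ℝ} (hq : IntegrableOn q (Ioo 0 T))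
    (hflux : ∀ n, ∀ᵐ t ∂(volume.restrict (Ioo a c)),
      ‖∫ x, inner ℝ (average (mollKernel (K n)) (j t) x)
        (average (mollKernel (K n)) (fun y => cross (j t y) (b t y)) x)‖ ≤ q t)
    {θ : ℝ → ℝ} (hθ : IsTimeTest a c θ) {C : ℝ} (hC : ∀ t, ‖θ t‖ ≤ C) :
    ‖∫ t in Ioo a c, (∫ x, ‖b t x‖ ^ 2) * deriv θ t‖ ≤ 2 * (C * ∫ t in Ioo 0 T, ‖q t‖) := by
  obtain ⟨D, hD0, -, hD⟩ := hθ.exists_bound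
  obtain ⟨M, hM0, hM⟩ := hb.exists_bound
  have hC0 : 0 ≤ C := (norm_nonneg _).trans (hC 0)
  have hsub : Ioo a c ⊆ Ioo 0 T := Ioo_subset_Ioo ha.le hc.le
  have hM' := ae_restrict_of_ae_restrict_of_subset hsub hM
  have hlim : Tendsto (fun n => ∫ t in Ioo a c,
      (∫ x, ‖average (mollKernel (K n)) (b t) x‖ ^ 2) * deriv θ t) atTop
      (𝓝 (∫ t in Ioo a c, (∫ x, ‖b t x‖ ^ 2) * deriv θ t)) := by
    refine tendsto_integral_of_dominated_convergence (fun _ => (3 * M) ^ 2 * D) (fun n => ?_)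
      (integrable_const _) (fun n => ?_) ?_
    · have h1 := stronglyMeasurable_average_param (continuous_mollKernel (hK n).smooth) hbm
      have h2 : StronglyMeasurable fun t => ∫ x, ‖average (mollKernel (K n)) (b t) x‖ ^ 2 :=
        StronglyMeasurable.integral_prod_right' (h1.norm.pow 2)
      exact (h2.mul hθ.continuous_deriv.stronglyMeasurable).aestronglyMeasurable
    · filter_upwards [hM'] with t ht
      rw [norm_mul, Real.norm_of_nonneg (integral_nonneg fun x => by positivity)]
      gcongr
      · exact integral_norm_sq_average_le (hK n) ht.1 (hbm.comp measurable_prodMk_left) hM0 ht.2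
      · exact hD t
    · filter_upwards [hM'] with t ht
      exact (tendsto_integral_norm_sq_average hε hK ht.1
        (hbm.comp measurable_prodMk_left)).mul_const _
  refine le_of_tendsto hlim.norm (Eventually.of_forall fun n => ?_)
  rw [hb.integral_norm_sq_average hbm hjm ha hac hc (hK n).smooth hθ, norm_mul, Real.norm_ofNat]
  gcongr
  have hq' : IntegrableOn (fun t => C * ‖q t‖) (Ioo 0 T) := hq.norm.const_mul C
  refine (norm_integral_le_of_norm_le (hq'.mono_set hsub) ?_).trans ?_
  · filter_upwards [hflux n] with t ht
    rw [norm_mul, mul_comm]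
    gcongr
    · exact hC t
    · exact ht.trans (le_abs_self _)
  · rw [← integral_const_mul]
    exact setIntegral_mono_set hq' (ae_of_all _ fun t => by positivity) hsub.eventuallyLE

/-- The minimum with T/4 and the maximum with T/2 keep `a < c` even when the given support interval
is empty. -/
lemma IsTimeTest.exists_subinterval {θ : ℝ → ℝ} (hT : 0 < T) (hθ : IsTimeTest 0 T θ) :
    ∃ a c, 0 < a ∧ a < c ∧ c < T ∧ IsTimeTest a c θ := by
  obtain ⟨a', c', h1, h2, h3⟩ := hθ.support
  refine ⟨min (a' / 2) (T / 4), max ((c' + T) / 2) (T / 2), lt_min (by linarith) (by linarith),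
    ?_, max_lt (by linarith) (by linarith), hθ.smooth, a', c', ?_, ?_, h3⟩
  · exact (min_le_right _ _).trans_lt (lt_of_lt_of_le (by linarith) (le_max_right _ _))
  · exact (min_le_left _ _).trans_lt (by linarith)
  · exact lt_of_lt_of_le (by linarith) (le_max_left _ _)

variable {r₁ r₂ α β : ℝ} {C₁ C₂ : ℝ → ℝ} {σ₁ σ₂ : E3 → ℝ} {ρ K : ℝ}

/-- Conservation of the energy for jointly measurable fields. -/
lemma IsWeakSolution.energy_ae_const (hT : 0 < T) (hb : IsWeakSolution T b j)
    (hbm : Measurable (Function.uncurry b)) (hjm : Measurable (Function.uncurry j))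
    (hr₁ : 1 < r₁) (hr₂ : 1 < r₂) (hr : 2 / r₁ + 1 / r₂ = 1) (hαβ : 1 ≤ 2 * α + β)
    (hC₁ : IntegrableOn C₁ (Ioo 0 T)) (hC₂ : IntegrableOn C₂ (Ioo 0 T))
    (hC₁_nonneg : ∀ t ∈ Ioo 0 T, 0 ≤ C₁ t) (hC₂_nonneg : ∀ t ∈ Ioo 0 T, 0 ≤ C₂ t) (hρ : 0 < ρ)
    (hσ₁ : ∀ ℓ, ‖ℓ‖ < ρ → 0 ≤ σ₁ ℓ ∧ σ₁ ℓ ≤ K) (hσ₂ : ∀ ℓ, ‖ℓ‖ < ρ → 0 ≤ σ₂ ℓ ∧ σ₂ ℓ ≤ K)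
    (hσ : Tendsto σ₁ (𝓝[≠] 0) (𝓝 0) ∨ Tendsto σ₂ (𝓝[≠] 0) (𝓝 0))
    (hb_incr : ∀ᵐ t ∂(volume.restrict (Ioo 0 T)), ∀ ℓ : E3, ‖ℓ‖ < ρ →
      eLpNorm (incr (b t) ℓ) (9 / 2) volume
        ≤ ENNReal.ofReal (C₁ t ^ (1 / r₁) * ‖ℓ‖ ^ α * σ₁ ℓ ^ (1 / 3 : ℝ)))
    (hj_incr : ∀ᵐ t ∂(volume.restrict (Ioo 0 T)), ∀ ℓ : E3, ‖ℓ‖ < ρ →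
      eLpNorm (incr (j t) ℓ) (9 / 5) volume
        ≤ ENNReal.ofReal (C₂ t ^ (1 / r₂) * ‖ℓ‖ ^ β * σ₂ ℓ ^ (1 / 3 : ℝ))) :
    ∃ E : ℝ, ∀ᵐ t ∂(volume.restrict (Ioo 0 T)), energy (b t) = E := by
  obtain ⟨M, hM0, hM⟩ := hb.exists_bound
  have hem : StronglyMeasurable fun t => ∫ x, ‖b t x‖ ^ 2 :=
    StronglyMeasurable.integral_prod_right' (f := fun p : ℝ × Torus L => ‖b p.1 p.2‖ ^ 2)
      (hbm.norm.pow_const 2).stronglyMeasurable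
  have heb : ∀ᵐ t ∂(volume.restrict (Ioo 0 T)), ‖∫ x, ‖b t x‖ ^ 2‖ ≤ M ^ 2 := by
    filter_upwards [hM] with t ht
    rw [Real.norm_of_nonneg (integral_nonneg fun x => by positivity),
      integral_norm_sq_eq ht.1.1]
    gcongr
    exact ENNReal.toReal_le_of_le_ofReal hM0 ht.2
  have hei : IntegrableOn (fun t => ∫ x, ‖b t x‖ ^ 2) (Ioo 0 T) :=
    Integrable.mono' (integrable_const _) hem.aestronglyMeasurable heb
  suffices h : ∀ θ, IsTimeTest 0 T θ →
      ∫ t in Ioo 0 T, (∫ x, ‖b t x‖ ^ 2) * deriv θ t = 0 by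
    obtain ⟨k, hk⟩ := ae_eq_const_of_weak_deriv_eq_zero hT hei h
    refine ⟨(1 / 2) * k, ?_⟩
    filter_upwards [hk] with t ht
    rw [energy, ht]
  intro θ hθ
  obtain ⟨a, c, ha, hac, hc, hθ'⟩ := hθ.exists_subinterval hT
  obtain ⟨C, hC0, hC, -⟩ := hθ'.exists_bound
  obtain ⟨A₀, hA₀, hker⟩ := exists_isAnnularKernel L
  have hLpos : 0 < L := Fact.out
  have hsub : Ioo a c ⊆ Ioo 0 T := Ioo_subset_Ioo ha.le hc.le
  have hrestr : ∫ t in Ioo 0 T, (∫ x, ‖b t x‖ ^ 2) * deriv θ t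
      = ∫ t in Ioo a c, (∫ x, ‖b t x‖ ^ 2) * deriv θ t := by
    refine setIntegral_eq_of_subset_of_forall_sdiff_eq_zero measurableSet_Ioo hsub fun t ht => ?_
    obtain ⟨a', c', h1, h2, h3⟩ := hθ'.support
    rw [deriv_eq_zero_of_notMem_Icc h3 fun h => ht.2 ⟨h1.trans_le h.1, h.2.trans_lt h2⟩, mul_zero]
  set Q : ℝ → ℝ := fun t => 2 / r₁ * C₁ t + 1 / r₂ * C₂ t with hQ
  have hQi : IntegrableOn Q (Ioo 0 T) := (hC₁.const_mul _).add (hC₂.const_mul _)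
  set B := 2 * A₀ * (4 ^ |β| * (4 ^ |α|) ^ 2) with hB
  have hB0 : 0 ≤ B := by positivity
  -- The moduli are frozen at level η, and every `ε n` is kept below the corresponding threshold.
  -- The limit in `n` is thus taken for fixed η, and η tends to 0 only afterwards.
  have hsmall : ∀ η : ℝ, 0 < η → ‖∫ t in Ioo a c, (∫ x, ‖b t x‖ ^ 2) * deriv θ t‖
      ≤ η * (2 * (C * (B * ∫ t in Ioo 0 T, ‖Q t‖))) := by
    intro η hη
    obtain ⟨s₁, s₂, δ, hs₁, hs₂, hδ, hδρ, hs, hmod⟩ := exists_modulus hρ hσ₁ hσ₂ hσ hη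
    -- The factor 8 leaves room for 4ε < δ (shifts in the range of the moduli), ε ≤ 1 (monotonicity
    -- of powers) and 2ε < L (one period).
    set d := min (min δ 1) L / 8 with hd
    have hd0 : 0 < d := by positivity
    have hdδ : 8 * d ≤ δ := by
      rw [hd]; linarith [(min_le_left (min δ 1) L).trans (min_le_left δ 1)]
    have hd1 : 8 * d ≤ 1 := by
      rw [hd]; linarith [(min_le_left (min δ 1) L).trans (min_le_right δ 1)]
    have hdL : 8 * d ≤ L := by
      rw [hd]; linarith [min_le_right (min δ 1) L]
    set ε : ℕ → ℝ := fun n => d * (1 / ((n : ℝ) + 1)) with hε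
    have hε0 : ∀ n, 0 < ε n := fun n => by positivity
    have hεd : ∀ n, ε n ≤ d := fun n =>
      mul_le_of_le_one_right hd0.le ((div_le_one (by positivity)).2 (by linarith [n.cast_nonneg (α := ℝ)]))
    have hεt : Tendsto ε atTop (𝓝 0) := by
      simpa [hε] using (tendsto_one_div_add_atTop_nhds_zero_nat (𝕜 := ℝ)).const_mul d
    choose Kn hKn using fun n => hker (ε n) (hε0 n) (by linarith [hεd n])
    have hflux : ∀ n, ∀ᵐ t ∂(volume.restrict (Ioo a c)),
        ‖∫ x, inner ℝ (average (mollKernel (Kn n)) (j t) x)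
          (average (mollKernel (Kn n)) (fun y => cross (j t y) (b t y)) x)‖ ≤ B * η * Q t := by
      intro n
      filter_upwards [ae_restrict_of_ae_restrict_of_subset hsub hM,
        ae_restrict_of_ae_restrict_of_subset hsub hb.current,
        ae_restrict_of_ae_restrict_of_subset hsub hb_incr,
        ae_restrict_of_ae_restrict_of_subset hsub hj_incr,
        (hb.integrable_nonlin ha hc).prod_right_ae,
        ae_restrict_mem measurableSet_Ioo] with t h1 h2 h3 h4 h5 h6
      have n1 := hC₁_nonneg t (hsub h6)
      have n2 := hC₂_nonneg t (hsub h6)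
      have hne : ∀ ℓ : E3, ε n ≤ ‖ℓ‖ → ℓ ≠ 0 := fun ℓ hℓ h0 => by
        rw [h0, norm_zero] at hℓ
        linarith [hε0 n]
      have hlt : ∀ ℓ : E3, ‖ℓ‖ ≤ 4 * ε n → ‖ℓ‖ < δ := fun ℓ hℓ => by linarith [hεd n]
      have key := norm_flux_le (hε0 n) (by linarith [hεd n]) hA₀ (hKn n) h2.2
        (h1.1.integrable (by norm_num)) h2.1 (hbm.comp measurable_prodMk_left)
        (hjm.comp measurable_prodMk_left) h5 hαβ (Real.rpow_nonneg n1 (1 / r₁))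
        (Real.rpow_nonneg n2 (1 / r₂)) hs₁ hs₂
        (fun ℓ hℓ hℓ' => (h3 ℓ ((hlt ℓ hℓ').trans_le hδρ)).trans (ENNReal.ofReal_le_ofReal (by
          gcongr
          exact (hmod ℓ (hne ℓ hℓ) (hlt ℓ hℓ')).1)))
        (fun ℓ hℓ hℓ' => (h4 ℓ ((hlt ℓ hℓ').trans_le hδρ)).trans (ENNReal.ofReal_le_ofReal (by
          gcongr
          exact (hmod ℓ (hne ℓ hℓ) (hlt ℓ hℓ')).2)))
      refine key.trans ?_
      gcongr
      exact sq_rpow_mul_rpow_le hr₁ hr₂ hr n1 n2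
    refine (abs_integral_energy_mul_deriv_le hb hbm hjm ha hac hc hεt hKn
      (hQi.const_mul (B * η)) hflux hθ' hC).trans_eq ?_
    simp_rw [norm_mul, Real.norm_of_nonneg hB0, Real.norm_of_nonneg hη.le]
    rw [integral_const_mul]
    ring
  rw [hrestr, ← norm_le_zero_iff]
  have ht : Tendsto (fun η : ℝ => η * (2 * (C * (B * ∫ t in Ioo 0 T, ‖Q t‖)))) (𝓝[>] 0)
      (𝓝 0) := by
    have : Tendsto (fun η : ℝ => η * (2 * (C * (B * ∫ t in Ioo 0 T, ‖Q t‖)))) (𝓝 0)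
        (𝓝 (0 * (2 * (C * (B * ∫ t in Ioo 0 T, ‖Q t‖))))) := tendsto_id.mul_const _
    rw [zero_mul] at this
    exact this.mono_left nhdsWithin_le_nhds
  exact ge_of_tendsto ht (eventually_nhdsWithin_of_forall fun η hη => hsmall η hη)

lemma incr_congr {U U' : Torus L → E3} (h : U =ᵐ[volume] U') (ℓ : E3) :
    incr U ℓ =ᵐ[volume] incr U' ℓ := by
  have mp := measurePreserving_add_right (volume : Measure (Torus L)) (proj L ℓ)
  filter_upwards [h, mp.quasiMeasurePreserving.ae h] with x h1 h2
  rw [incr, incr, h1, h2]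

/-- Conservation of the energy. -/
theorem IsWeakSolution.energy_conserved (hT : 0 < T) (hb : IsWeakSolution T b j)
    (hr₁ : 1 < r₁) (hr₂ : 1 < r₂) (hr : 2 / r₁ + 1 / r₂ = 1) (hαβ : 1 ≤ 2 * α + β)
    (hC₁ : IntegrableOn C₁ (Ioo 0 T)) (hC₂ : IntegrableOn C₂ (Ioo 0 T))
    (hC₁_nonneg : ∀ t ∈ Ioo 0 T, 0 ≤ C₁ t) (hC₂_nonneg : ∀ t ∈ Ioo 0 T, 0 ≤ C₂ t) (hρ : 0 < ρ)
    (hσ₁ : ∀ ℓ, ‖ℓ‖ < ρ → 0 ≤ σ₁ ℓ ∧ σ₁ ℓ ≤ K) (hσ₂ : ∀ ℓ, ‖ℓ‖ < ρ → 0 ≤ σ₂ ℓ ∧ σ₂ ℓ ≤ K)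
    (hσ : Tendsto σ₁ (𝓝[≠] 0) (𝓝 0) ∨ Tendsto σ₂ (𝓝[≠] 0) (𝓝 0))
    (hb_incr : ∀ᵐ t ∂(volume.restrict (Ioo 0 T)), ∀ ℓ : E3, ‖ℓ‖ < ρ →
      eLpNorm (incr (b t) ℓ) (9 / 2) volume
        ≤ ENNReal.ofReal (C₁ t ^ (1 / r₁) * ‖ℓ‖ ^ α * σ₁ ℓ ^ (1 / 3 : ℝ)))
    (hj_incr : ∀ᵐ t ∂(volume.restrict (Ioo 0 T)), ∀ ℓ : E3, ‖ℓ‖ < ρ →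
      eLpNorm (incr (j t) ℓ) (9 / 5) volume
        ≤ ENNReal.ofReal (C₂ t ^ (1 / r₂) * ‖ℓ‖ ^ β * σ₂ ℓ ^ (1 / 3 : ℝ))) :
    ∃ E : ℝ, ∀ᵐ t ∂(volume.restrict (Ioo 0 T)), energy (b t) = E := by
  -- Jointly measurable representatives are used because measurability in parameters is needed.
  -- Translations preserve null sets, so the increment bounds carry over.
  set b₁ : ℝ → Torus L → E3 := fun t x => hb.measurable_b.mk _ (t, x) with hb₁
  set j₁ : ℝ → Torus L → E3 := fun t x => hb.measurable_j.mk _ (t, x) with hj₁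
  have hbe : ∀ᵐ p ∂(spaceTime L T), b p.1 p.2 = b₁ p.1 p.2 := hb.measurable_b.ae_eq_mk
  have hje : ∀ᵐ p ∂(spaceTime L T), j p.1 p.2 = j₁ p.1 p.2 := hb.measurable_j.ae_eq_mk
  have hbt : ∀ᵐ t ∂(volume.restrict (Ioo 0 T)), b t =ᵐ[volume] b₁ t :=
    Measure.ae_ae_of_ae_prod hbe
  have hjt : ∀ᵐ t ∂(volume.restrict (Ioo 0 T)), j t =ᵐ[volume] j₁ t :=
    Measure.ae_ae_of_ae_prod hje
  obtain ⟨E, hE⟩ := (hb.congr hbe hje).energy_ae_const hT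
    hb.measurable_b.stronglyMeasurable_mk.measurable
    hb.measurable_j.stronglyMeasurable_mk.measurable hr₁ hr₂ hr hαβ hC₁ hC₂ hC₁_nonneg hC₂_nonneg
    hρ hσ₁ hσ₂ hσ
    (by
      filter_upwards [hb_incr, hbt] with t h1 h2 ℓ hℓ
      rw [← eLpNorm_congr_ae (incr_congr h2 ℓ)]
      exact h1 ℓ hℓ)
    (by
      filter_upwards [hj_incr, hjt] with t h1 h2 ℓ hℓ
      rw [← eLpNorm_congr_ae (incr_congr h2 ℓ)]
      exact h1 ℓ hℓ)
  refine ⟨E, ?_⟩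
  filter_upwards [hE, hbt] with t h1 h2
  rw [← h1, energy, energy]
  congr 1
  refine integral_congr_ae ?_
  filter_upwards [h2] with x hx
  rw [hx]

end conservation

/-! ### The standard mollifier and its gradient -/

section mollifier

lemma bump_eq (y : E3) : bump y = expNegInvGlue (1 - ‖y‖ ^ 2) := by
  unfold bump expNegInvGlue
  have h0 := norm_nonneg y
  by_cases h : ‖y‖ < 1
  · have : ¬ (1 - ‖y‖ ^ 2 ≤ 0) := by nlinarith
    rw [if_pos h, if_neg this, neg_div, one_div]
  · have : 1 - ‖y‖ ^ 2 ≤ 0 := by nlinarith [not_lt.1 h]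
    rw [if_neg h, if_pos this]

lemma contDiff_bump : ContDiff ℝ ∞ bump := by
  have : bump = fun y => expNegInvGlue (1 - ‖y‖ ^ 2) := funext bump_eq
  rw [this]
  exact expNegInvGlue.contDiff.comp (contDiff_const.sub (contDiff_norm_sq ℝ))

lemma hasCompactSupport_bump : HasCompactSupport bump := by
  refine HasCompactSupport.intro (isCompact_closedBall (0 : E3) 1) fun y hy => ?_
  rw [mem_closedBall_zero_iff, not_le] at hy
  rw [bump, if_neg hy.not_gt]

lemma contDiff_mollifier (ε : ℝ) : ContDiff ℝ ∞ (mollifier ε) :=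
  contDiff_const.mul (contDiff_const.mul
    (contDiff_bump.comp (contDiff_id.const_smul ε⁻¹)))

lemma continuous_gradient_mollifier (ε : ℝ) : Continuous (gradient (mollifier ε)) :=
  (InnerProductSpace.toDual ℝ E3).symm.continuous.comp
    ((contDiff_mollifier ε).continuous_fderiv (by simp))

lemma gradient_mollifier_eq_zero {ε : ℝ} (hε : 0 < ε) {ℓ : E3} (hℓ : ε < ‖ℓ‖) :
    gradient (mollifier ε) ℓ = 0 := by
  have h : mollifier ε =ᶠ[𝓝 ℓ] fun _ => 0 := by
    filter_upwards [(isOpen_lt continuous_const continuous_norm).mem_nhds hℓ] with y hy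
    have : ¬ ‖ε⁻¹ • y‖ < 1 := by
      rw [norm_smul, norm_inv, Real.norm_of_nonneg hε.le, inv_mul_lt_iff₀ hε, mul_one]
      exact not_lt.2 (le_of_lt hy)
    rw [mollifier, bump, if_neg this, mul_zero, mul_zero]
  rw [gradient, h.fderiv_eq]
  simp

/-- The gradient has size ε⁻⁴ on a ball of volume of order ε³. -/
lemma exists_lintegral_gradient_mollifier_le : ∃ H : ℝ, 0 ≤ H ∧ ∀ ε : ℝ, 0 < ε →
    ∫⁻ ℓ, ‖gradient (mollifier ε) ℓ‖ₑ ≤ ENNReal.ofReal (H / ε) := by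
  obtain ⟨G, hG⟩ := (hasCompactSupport_bump.fderiv ℝ).exists_bound_of_continuous
    (contDiff_bump.continuous_fderiv (by simp))
  have hG0 : 0 ≤ G := (norm_nonneg _).trans (hG 0)
  set c := (∫ z : E3, bump z)⁻¹ with hc
  set V := (volume (Metric.ball (0 : E3) 1)).toReal with hV
  refine ⟨|c| * G * V, by positivity, fun ε hε => ?_⟩
  have hbound : ∀ ℓ, ‖gradient (mollifier ε) ℓ‖ ≤ (ε ^ 3)⁻¹ * |c| * G * ε⁻¹ := by
    intro ℓ
    have h1 : HasFDerivAt (fun y : E3 => ε⁻¹ • y) (ε⁻¹ • ContinuousLinearMap.id ℝ E3) ℓ :=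
      (hasFDerivAt_id ℓ).const_smul ε⁻¹
    have h2 := ((contDiff_bump.differentiable (by simp)) (ε⁻¹ • ℓ)).hasFDerivAt.comp ℓ h1
    have h3 := (h2.const_mul c).const_mul (ε ^ 3)⁻¹
    have h4 : fderiv ℝ (mollifier ε) ℓ = _ := h3.fderiv
    rw [gradient, LinearIsometryEquiv.norm_map, h4, norm_smul, norm_smul, norm_inv,
      Real.norm_of_nonneg (by positivity : 0 ≤ ε ^ 3), Real.norm_eq_abs]
    have h5 : ‖(fderiv ℝ bump (ε⁻¹ • ℓ)).comp (ε⁻¹ • ContinuousLinearMap.id ℝ E3)‖ ≤ G * ε⁻¹ := by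
      refine (ContinuousLinearMap.opNorm_comp_le _ _).trans ?_
      gcongr
      · exact hG _
      · rw [norm_smul, norm_inv, Real.norm_of_nonneg hε.le]
        exact mul_le_of_le_one_right (by positivity) ContinuousLinearMap.norm_id_le
    calc _ ≤ (ε ^ 3)⁻¹ * (|c| * (G * ε⁻¹)) := by gcongr
      _ = _ := by ring
  calc ∫⁻ ℓ, ‖gradient (mollifier ε) ℓ‖ₑ
      ≤ ∫⁻ ℓ, (Metric.closedBall (0 : E3) ε).indicator
          (fun _ => ENNReal.ofReal ((ε ^ 3)⁻¹ * |c| * G * ε⁻¹)) ℓ := by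
        refine lintegral_mono fun ℓ => ?_
        by_cases hℓ : ε < ‖ℓ‖
        · simp [gradient_mollifier_eq_zero hε hℓ]
        · rw [indicator_of_mem (by simpa using hℓ), ← ofReal_norm]
          exact ENNReal.ofReal_le_ofReal (hbound ℓ)
    _ = ENNReal.ofReal ((ε ^ 3)⁻¹ * |c| * G * ε⁻¹) * volume (Metric.closedBall (0 : E3) ε) := by
        rw [lintegral_indicator_const Metric.isClosed_closedBall.measurableSet]
    _ = ENNReal.ofReal (|c| * G * V / ε) := by
        rw [Measure.addHaar_closedBall _ _ hε.le, finrank_euclideanSpace_fin,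
          ← ENNReal.ofReal_toReal (measure_ball_lt_top (μ := volume) (x := (0 : E3)) (r := 1)).ne,
          ← ENNReal.ofReal_mul (by positivity), ← ENNReal.ofReal_mul (by positivity), ← hV]
        congr 1
        field_simp

end mollifier

/-! ### The dissipation term -/

section dissipation

variable {L : ℝ} [Fact (0 < L)] {T : ℝ} {b j : ℝ → Torus L → E3}

omit [Fact (0 < L)] in
lemma enorm_dissipation_le (b j : ℝ → Torus L → E3) (ε t : ℝ) (x : Torus L) :
    ‖dissipation b j ε t x‖ₑ ≤ ∫⁻ ℓ : E3, ‖gradient (mollifier ε) ℓ‖ₑ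
      * (‖incr (j t) ℓ x‖ₑ * (‖incr (b t) ℓ x‖ₑ * ‖incr (b t) ℓ x‖ₑ)) := by
  set I := ∫⁻ ℓ : E3, ‖gradient (mollifier ε) ℓ‖ₑ
      * (‖incr (j t) ℓ x‖ₑ * (‖incr (b t) ℓ x‖ₑ * ‖incr (b t) ℓ x‖ₑ)) with hI
  have h1 : ‖∫ ℓ : E3, inner ℝ (gradient (mollifier ε) ℓ) (incr (j t) ℓ x)
      * ‖incr (b t) ℓ x‖ ^ 2‖ₑ ≤ I := by
    refine (enorm_integral_le_lintegral_enorm _).trans (lintegral_mono fun ℓ => ?_)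
    rw [enorm_mul, enorm_pow, enorm_norm, pow_two]
    exact (mul_le_mul' (enorm_inner_le _ _) le_rfl).trans_eq (mul_assoc _ _ _)
  have h2 : ‖∫ ℓ : E3, inner ℝ (gradient (mollifier ε) ℓ) (incr (b t) ℓ x)
      * inner ℝ (incr (j t) ℓ x) (incr (b t) ℓ x)‖ₑ ≤ I := by
    refine (enorm_integral_le_lintegral_enorm _).trans (lintegral_mono fun ℓ => ?_)
    rw [enorm_mul]
    refine (mul_le_mul' (enorm_inner_le _ _) (enorm_inner_le _ _)).trans_eq ?_
    ring
  unfold dissipation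
  refine enorm_sub_le.trans ?_
  rw [enorm_mul, enorm_mul]
  -- Rounding both coefficients up to 1/2 makes them add up to 1.
  have e1 : ‖(1 / 8 : ℝ)‖ₑ ≤ ENNReal.ofReal (1 / 2) := by
    rw [← ofReal_norm]
    exact ENNReal.ofReal_le_ofReal (by norm_num)
  have e2 : ‖(1 / 4 : ℝ)‖ₑ ≤ ENNReal.ofReal (1 / 2) := by
    rw [← ofReal_norm]
    exact ENNReal.ofReal_le_ofReal (by norm_num)
  refine (add_le_add (mul_le_mul' e1 h1) (mul_le_mul' e2 h2)).trans_eq ?_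
  rw [← add_mul, ← ENNReal.ofReal_add (by norm_num) (by norm_num)]
  norm_num

lemma measurePreserving_translate (T : ℝ) (z : Torus L) :
    MeasurePreserving (fun p : ℝ × Torus L => (p.1, p.2 + z)) (spaceTime L T) (spaceTime L T) :=
  (MeasurePreserving.id _).prod (measurePreserving_add_right volume z)

lemma aestronglyMeasurable_incr {f : ℝ → Torus L → E3}
    (hf : AEStronglyMeasurable (fun p : ℝ × Torus L => f p.1 p.2) (spaceTime L T)) (ℓ : E3) :
    AEStronglyMeasurable (fun p : ℝ × Torus L => incr (f p.1) ℓ p.2) (spaceTime L T) :=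
  (hf.comp_measurePreserving (measurePreserving_translate T (proj L ℓ))).sub hf

instance : SFinite (spaceTime L T) := by
  unfold spaceTime; infer_instance

/-- For each fixed shift, translation preserves the space-time measure. The joint map is therefore
quasi-measure-preserving, and almost-everywhere measurability pulls back. -/
lemma aestronglyMeasurable_incr_prod {f : ℝ → Torus L → E3}
    (hf : AEStronglyMeasurable (fun p : ℝ × Torus L => f p.1 p.2) (spaceTime L T)) :
    AEStronglyMeasurable (fun q : (ℝ × Torus L) × E3 => incr (f q.1.1) q.2 q.1.2)
      ((spaceTime L T).prod volume) := by
  have hm : Measurable fun q : (ℝ × Torus L) × E3 => (q.1.1, q.1.2 + proj L q.2) :=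
    (measurable_fst.comp measurable_fst).prodMk
      ((measurable_snd.comp measurable_fst).add (measurable_proj.comp measurable_snd))
  have hq : Measure.QuasiMeasurePreserving
      (fun q : (ℝ × Torus L) × E3 => (q.1.1, q.1.2 + proj L q.2))
      ((spaceTime L T).prod volume) (spaceTime L T) :=
    QuasiMeasurePreserving.prod_of_left hm
      (ae_of_all _ fun ℓ => (measurePreserving_translate T (proj L ℓ)).quasiMeasurePreserving)
  exact (hf.comp_quasiMeasurePreserving hq).sub
    (hf.comp_quasiMeasurePreserving Measure.quasiMeasurePreserving_fst)

lemma aestronglyMeasurable_dissipation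
    (hb : AEStronglyMeasurable (fun p : ℝ × Torus L => b p.1 p.2) (spaceTime L T))
    (hj : AEStronglyMeasurable (fun p : ℝ × Torus L => j p.1 p.2) (spaceTime L T)) (ε : ℝ) :
    AEStronglyMeasurable (fun p : ℝ × Torus L => dissipation b j ε p.1 p.2) (spaceTime L T) := by
  have mb := aestronglyMeasurable_incr_prod hb
  have mj := aestronglyMeasurable_incr_prod hj
  have mg : AEStronglyMeasurable (fun q : (ℝ × Torus L) × E3 => gradient (mollifier ε) q.2)
      ((spaceTime L T).prod volume) :=
    ((continuous_gradient_mollifier ε).comp continuous_snd).aestronglyMeasurable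
  have h1 := ((mg.inner (𝕜 := ℝ) mj).mul (mb.norm.pow 2)).integral_prod_right'
  have h2 := ((mg.inner (𝕜 := ℝ) mb).mul (mj.inner (𝕜 := ℝ) mb)).integral_prod_right'
  exact (h1.const_mul (1 / 8)).sub (h2.const_mul (1 / 4))

lemma lintegral_lintegral_mul_le {X Y : Type*} [MeasurableSpace X] [MeasurableSpace Y]
    {μ : Measure X} {ν : Measure Y} [SFinite μ] [SFinite ν] {g : Y → ℝ≥0∞} {W : X → Y → ℝ≥0∞}
    {c : ℝ≥0∞} (hg : Measurable g) (hW : AEMeasurable (Function.uncurry W) (μ.prod ν))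
    (hWy : ∀ y, AEMeasurable (fun x => W x y) μ)
    (hc : ∀ y, g y = 0 ∨ ∫⁻ x, W x y ∂μ ≤ c) :
    ∫⁻ x, ∫⁻ y, g y * W x y ∂ν ∂μ ≤ (∫⁻ y, g y ∂ν) * c := by
  rw [lintegral_lintegral_swap ((hg.comp measurable_snd).aemeasurable.mul hW),
    ← lintegral_mul_const _ hg]
  refine lintegral_mono fun y => (lintegral_const_mul'' _ (hWy y)).trans_le ?_
  rcases hc y with h | h
  · rw [h, zero_mul, zero_mul]
  · exact mul_le_mul' le_rfl h

omit [Fact (0 < L)] in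
lemma incr_zero (f : Torus L → E3) (x : Torus L) : incr f 0 x = 0 := by
  have h : proj L (0 : E3) = 0 := by ext i; simp [proj]
  rw [incr, h, add_zero, sub_self]

/-- The integrand that controls the dissipation term at time `t`, position `x`, shift `ℓ`. -/
def tripleIncr (b j : ℝ → Torus L → E3) (p : ℝ × Torus L) (ℓ : E3) : ℝ≥0∞ :=
  ‖incr (j p.1) ℓ p.2‖ₑ * (‖incr (b p.1) ℓ p.2‖ₑ * ‖incr (b p.1) ℓ p.2‖ₑ)

lemma aemeasurable_tripleIncr
    (hb : AEStronglyMeasurable (fun p : ℝ × Torus L => b p.1 p.2) (spaceTime L T))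
    (hj : AEStronglyMeasurable (fun p : ℝ × Torus L => j p.1 p.2) (spaceTime L T)) (ℓ : E3) :
    AEMeasurable (fun p => tripleIncr b j p ℓ) (spaceTime L T) :=
  (aestronglyMeasurable_incr hj ℓ).enorm.mul
    ((aestronglyMeasurable_incr hb ℓ).enorm.mul (aestronglyMeasurable_incr hb ℓ).enorm)

lemma aemeasurable_uncurry_tripleIncr
    (hb : AEStronglyMeasurable (fun p : ℝ × Torus L => b p.1 p.2) (spaceTime L T))
    (hj : AEStronglyMeasurable (fun p : ℝ × Torus L => j p.1 p.2) (spaceTime L T)) :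
    AEMeasurable (Function.uncurry (tripleIncr b j)) ((spaceTime L T).prod volume) :=
  (aestronglyMeasurable_incr_prod hj).enorm.mul
    ((aestronglyMeasurable_incr_prod hb).enorm.mul (aestronglyMeasurable_incr_prod hb).enorm)

lemma lintegral_tripleIncr_le
    (hb : AEStronglyMeasurable (fun p : ℝ × Torus L => b p.1 p.2) (spaceTime L T))
    (hj : AEStronglyMeasurable (fun p : ℝ × Torus L => j p.1 p.2) (spaceTime L T)) {ℓ : E3}
    {B : ℝ → ℝ≥0∞}
    (hB : ∀ᵐ t ∂(volume.restrict (Ioo 0 T)),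
      eLpNorm (incr (j t) ℓ) (9 / 5) volume * (eLpNorm (incr (b t) ℓ) (9 / 2) volume
        * eLpNorm (incr (b t) ℓ) (9 / 2) volume) ≤ B t) :
    ∫⁻ p, tripleIncr b j p ℓ ∂(spaceTime L T) ≤ ∫⁻ t in Ioo 0 T, B t := by
  have h := aemeasurable_tripleIncr hb hj ℓ
  unfold spaceTime at h ⊢
  rw [lintegral_prod _ h]
  refine lintegral_mono_ae ?_
  have mjt := (aestronglyMeasurable_incr hj ℓ).prodMk_left
  have mbt := (aestronglyMeasurable_incr hb ℓ).prodMk_left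
  filter_upwards [hB, mjt, mbt] with t h1 h2 h3
  exact (lintegral_enorm_mul_mul_le h2 h3 h3).trans h1

lemma lintegral_enorm_dissipation_le
    (hb : AEStronglyMeasurable (fun p : ℝ × Torus L => b p.1 p.2) (spaceTime L T))
    (hj : AEStronglyMeasurable (fun p : ℝ × Torus L => j p.1 p.2) (spaceTime L T)) {ε : ℝ}
    (hε : 0 < ε) {B : ℝ → ℝ≥0∞}
    (hB : ∀ ℓ : E3, ℓ ≠ 0 → ‖ℓ‖ ≤ ε → ∀ᵐ t ∂(volume.restrict (Ioo 0 T)),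
      eLpNorm (incr (j t) ℓ) (9 / 5) volume * (eLpNorm (incr (b t) ℓ) (9 / 2) volume
        * eLpNorm (incr (b t) ℓ) (9 / 2) volume) ≤ B t) :
    ∫⁻ p, ‖dissipation b j ε p.1 p.2‖ₑ ∂(spaceTime L T)
      ≤ (∫⁻ ℓ, ‖gradient (mollifier ε) ℓ‖ₑ) * ∫⁻ t in Ioo 0 T, B t := by
  have h1 : ∫⁻ p, ‖dissipation b j ε p.1 p.2‖ₑ ∂(spaceTime L T)
      ≤ ∫⁻ p, (∫⁻ ℓ, ‖gradient (mollifier ε) ℓ‖ₑ * tripleIncr b j p ℓ) ∂(spaceTime L T) :=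
    lintegral_mono fun p => enorm_dissipation_le b j ε p.1 p.2
  refine h1.trans (lintegral_lintegral_mul_le
    (continuous_gradient_mollifier ε).measurable.enorm
    (aemeasurable_uncurry_tripleIncr hb hj) (aemeasurable_tripleIncr hb hj) fun ℓ => ?_)
  by_cases hℓ : ε < ‖ℓ‖
  · left
    rw [gradient_mollifier_eq_zero hε hℓ, enorm_zero]
  right
  -- The assumed bound excludes ℓ = 0, but there every increment vanishes.
  by_cases h0 : ℓ = 0
  · simp [h0, tripleIncr, incr_zero]
  exact lintegral_tripleIncr_le hb hj (hB ℓ h0 (not_lt.1 hℓ))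

variable {r₁ r₂ α β : ℝ} {C₁ C₂ : ℝ → ℝ} {σ₁ σ₂ : E3 → ℝ} {ρ K : ℝ}

/-- The dissipation term of the energy vanishes. -/
theorem IsWeakSolution.dissipation_vanishes (hb : IsWeakSolution T b j)
    (hr₁ : 1 < r₁) (hr₂ : 1 < r₂) (hr : 2 / r₁ + 1 / r₂ = 1) (hαβ : 1 ≤ 2 * α + β)
    (hC₁ : IntegrableOn C₁ (Ioo 0 T)) (hC₂ : IntegrableOn C₂ (Ioo 0 T))
    (hC₁_nonneg : ∀ t ∈ Ioo 0 T, 0 ≤ C₁ t) (hC₂_nonneg : ∀ t ∈ Ioo 0 T, 0 ≤ C₂ t) (hρ : 0 < ρ)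
    (hσ₁ : ∀ ℓ, ‖ℓ‖ < ρ → 0 ≤ σ₁ ℓ ∧ σ₁ ℓ ≤ K) (hσ₂ : ∀ ℓ, ‖ℓ‖ < ρ → 0 ≤ σ₂ ℓ ∧ σ₂ ℓ ≤ K)
    (hσ : Tendsto σ₁ (𝓝[≠] 0) (𝓝 0) ∨ Tendsto σ₂ (𝓝[≠] 0) (𝓝 0))
    (hb_incr : ∀ᵐ t ∂(volume.restrict (Ioo 0 T)), ∀ ℓ : E3, ‖ℓ‖ < ρ →
      eLpNorm (incr (b t) ℓ) (9 / 2) volume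
        ≤ ENNReal.ofReal (C₁ t ^ (1 / r₁) * ‖ℓ‖ ^ α * σ₁ ℓ ^ (1 / 3 : ℝ)))
    (hj_incr : ∀ᵐ t ∂(volume.restrict (Ioo 0 T)), ∀ ℓ : E3, ‖ℓ‖ < ρ →
      eLpNorm (incr (j t) ℓ) (9 / 5) volume
        ≤ ENNReal.ofReal (C₂ t ^ (1 / r₂) * ‖ℓ‖ ^ β * σ₂ ℓ ^ (1 / 3 : ℝ))) :
    (∀ᶠ ε in 𝓝[>] (0 : ℝ), Integrable
        (fun p : ℝ × Torus L => dissipation b j ε p.1 p.2) (spaceTime L T)) ∧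
      Tendsto (fun ε : ℝ => ∫⁻ p, ‖dissipation b j ε p.1 p.2‖ₑ ∂(spaceTime L T))
        (𝓝[>] 0) (𝓝 0) := by
  obtain ⟨H, hH0, hH⟩ := exists_lintegral_gradient_mollifier_le
  set Q : ℝ → ℝ := fun t => 2 / r₁ * C₁ t + 1 / r₂ * C₂ t with hQ
  have hQi : IntegrableOn Q (Ioo 0 T) := (hC₁.const_mul _).add (hC₂.const_mul _)
  set q : ℝ := ∫ t in Ioo 0 T, ‖Q t‖ with hq
  have hq0 : 0 ≤ q := integral_nonneg fun t => norm_nonneg _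
  have hQq : ∫⁻ t in Ioo 0 T, ENNReal.ofReal (Q t) ≤ ENNReal.ofReal q := by
    rw [hq, ofReal_integral_norm_eq_lintegral_enorm hQi]
    refine lintegral_mono fun t => ?_
    rw [← ofReal_norm]
    exact ENNReal.ofReal_le_ofReal (le_abs_self _)
  have main : ∀ η : ℝ, 0 < η → ∀ᶠ ε in 𝓝[>] (0 : ℝ),
      ∫⁻ p, ‖dissipation b j ε p.1 p.2‖ₑ ∂(spaceTime L T) ≤ ENNReal.ofReal (η * (H * q)) := by
    intro η hη
    obtain ⟨s₁, s₂, δ, hs₁, hs₂, hδ, hδρ, hs, hmod⟩ := exists_modulus hρ hσ₁ hσ₂ hσ hη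
    filter_upwards [Ioo_mem_nhdsGT (lt_min hδ one_pos)] with ε hε
    have hε0 : 0 < ε := hε.1
    have hεδ : ε < δ := hε.2.trans_le (min_le_left _ _)
    have hε1 : ε ≤ 1 := (hε.2.trans_le (min_le_right _ _)).le
    have hB : ∀ ℓ : E3, ℓ ≠ 0 → ‖ℓ‖ ≤ ε → ∀ᵐ t ∂(volume.restrict (Ioo 0 T)),
        eLpNorm (incr (j t) ℓ) (9 / 5) volume * (eLpNorm (incr (b t) ℓ) (9 / 2) volume
          * eLpNorm (incr (b t) ℓ) (9 / 2) volume)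
          ≤ ENNReal.ofReal (ε * η) * ENNReal.ofReal (Q t) := by
      intro ℓ h0 hℓ
      filter_upwards [hb_incr, hj_incr, ae_restrict_mem measurableSet_Ioo] with t h1 h2 h3
      have n1 := hC₁_nonneg t h3
      have n2 := hC₂_nonneg t h3
      have hp : 0 < ‖ℓ‖ := norm_pos_iff.2 h0
      have hlt := hℓ.trans_lt hεδ
      obtain ⟨m1, m2⟩ := hmod ℓ h0 hlt
      have g1 := (hσ₁ ℓ (hlt.trans_le hδρ)).1
      have g2 := (hσ₂ ℓ (hlt.trans_le hδρ)).1
      have b1 := h1 ℓ (hlt.trans_le hδρ)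
      have b2 := h2 ℓ (hlt.trans_le hδρ)
      refine (mul_le_mul' b2 (mul_le_mul' b1 b1)).trans ?_
      rw [← ENNReal.ofReal_mul (by positivity), ← ENNReal.ofReal_mul (by positivity),
        ← ENNReal.ofReal_mul (by positivity)]
      refine ENNReal.ofReal_le_ofReal ?_
      -- All increments share the shift ℓ, so the exponents add up before being compared with 1.
      -- Hence no lower bound on |ℓ| is needed.
      have hpow : ‖ℓ‖ ^ β * (‖ℓ‖ ^ α * ‖ℓ‖ ^ α) ≤ ε := by
        rw [← Real.rpow_add hp, ← Real.rpow_add hp]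
        calc ‖ℓ‖ ^ (β + (α + α)) ≤ ‖ℓ‖ ^ (1 : ℝ) :=
              Real.rpow_le_rpow_of_exponent_ge hp (hℓ.trans hε1) (by linarith)
          _ = ‖ℓ‖ := Real.rpow_one _
          _ ≤ ε := hℓ
      have hss : (σ₁ ℓ ^ (1 / 3 : ℝ)) ^ 2 * σ₂ ℓ ^ (1 / 3 : ℝ) ≤ η :=
        le_trans (by gcongr) hs
      have hCC := sq_rpow_mul_rpow_le hr₁ hr₂ hr n1 n2
      calc _ = (‖ℓ‖ ^ β * (‖ℓ‖ ^ α * ‖ℓ‖ ^ α)) * ((σ₁ ℓ ^ (1 / 3 : ℝ)) ^ 2 * σ₂ ℓ ^ (1 / 3 : ℝ))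
            * ((C₁ t ^ (1 / r₁)) ^ 2 * C₂ t ^ (1 / r₂)) := by ring
        _ ≤ ε * η * Q t := by gcongr
    refine (lintegral_enorm_dissipation_le hb.measurable_b hb.measurable_j hε0 hB).trans ?_
    rw [lintegral_const_mul' _ _ ENNReal.ofReal_ne_top]
    calc _ ≤ ENNReal.ofReal (H / ε) * (ENNReal.ofReal (ε * η) * ENNReal.ofReal q) :=
          mul_le_mul' (hH ε hε0) (mul_le_mul' le_rfl hQq)
      _ = ENNReal.ofReal (η * (H * q)) := by
          rw [← ENNReal.ofReal_mul (by positivity), ← ENNReal.ofReal_mul (by positivity)]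
          congr 1
          -- The factor ε gained from the increments cancels the 1/ε of the gradient, leaving η
          -- times a constant.
          field_simp
  refine ⟨?_, ?_⟩
  · filter_upwards [main 1 one_pos] with ε hε
    exact ⟨aestronglyMeasurable_dissipation hb.measurable_b hb.measurable_j ε,
      hε.trans_lt ENNReal.ofReal_lt_top⟩
  · rw [ENNReal.tendsto_nhds_zero]
    intro γ hγ
    have ht : Tendsto (fun η : ℝ => ENNReal.ofReal (η * (H * q))) (𝓝[>] 0) (𝓝 0) := by
      have : Tendsto (fun η : ℝ => ENNReal.ofReal (η * (H * q))) (𝓝 0)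
          (𝓝 (ENNReal.ofReal (0 * (H * q)))) :=
        (ENNReal.continuous_ofReal.tendsto _).comp (tendsto_id.mul_const _)
      rw [zero_mul, ENNReal.ofReal_zero] at this
      exact this.mono_left nhdsWithin_le_nhds
    obtain ⟨η, hη, hηpos⟩ :=
      ((ENNReal.tendsto_nhds_zero.1 ht γ hγ).and self_mem_nhdsWithin).exists
    filter_upwards [main η hηpos] with ε hε using hε.trans hη

end dissipation

end EMHD

end

theorem corollary1p6 (L T : ℝ) [Fact (0 < L)] (hT : 0 < T)
    (b j : ℝ → EMHD.Torus L → EMHD.E3) (hb : EMHD.IsWeakSolution T b j)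
    (r₁ r₂ α β : ℝ) (hr₁ : 1 < r₁) (hr₂ : 1 < r₂) (hr : 2 / r₁ + 1 / r₂ = 1)
    (hαβ : 1 ≤ 2 * α + β)
    (C₁ C₂ : ℝ → ℝ)
    (hC₁ : IntegrableOn C₁ (Ioo 0 T)) (hC₂ : IntegrableOn C₂ (Ioo 0 T))
    (hC₁_nonneg : ∀ t ∈ Ioo 0 T, 0 ≤ C₁ t) (hC₂_nonneg : ∀ t ∈ Ioo 0 T, 0 ≤ C₂ t)
    (σ₁ σ₂ : EMHD.E3 → ℝ) (ρ K : ℝ) (hρ : 0 < ρ)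
    (hσ₁ : ∀ ℓ, ‖ℓ‖ < ρ → 0 ≤ σ₁ ℓ ∧ σ₁ ℓ ≤ K)
    (hσ₂ : ∀ ℓ, ‖ℓ‖ < ρ → 0 ≤ σ₂ ℓ ∧ σ₂ ℓ ≤ K)
    (hσ : Tendsto σ₁ (𝓝[≠] 0) (𝓝 0) ∨ Tendsto σ₂ (𝓝[≠] 0) (𝓝 0))
    (hb_incr : ∀ᵐ t ∂(volume.restrict (Ioo 0 T)), ∀ ℓ : EMHD.E3, ‖ℓ‖ < ρ →
      eLpNorm (EMHD.incr (b t) ℓ) (9 / 2) volume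
        ≤ ENNReal.ofReal (C₁ t ^ (1 / r₁) * ‖ℓ‖ ^ α * σ₁ ℓ ^ (1 / 3 : ℝ)))
    (hj_incr : ∀ᵐ t ∂(volume.restrict (Ioo 0 T)), ∀ ℓ : EMHD.E3, ‖ℓ‖ < ρ →
      eLpNorm (EMHD.incr (j t) ℓ) (9 / 5) volume
        ≤ ENNReal.ofReal (C₂ t ^ (1 / r₂) * ‖ℓ‖ ^ β * σ₂ ℓ ^ (1 / 3 : ℝ))) :
    -- the dissipation term vanishes: `D(b,j;ε) → 0` in `L¹((0,T) × 𝕋³)`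
    ((∀ᶠ ε in 𝓝[>] (0 : ℝ), Integrable
        (fun p : ℝ × EMHD.Torus L => EMHD.dissipation b j ε p.1 p.2) (EMHD.spaceTime L T)) ∧
      Tendsto (fun ε : ℝ => ∫⁻ p, ‖EMHD.dissipation b j ε p.1 p.2‖ₑ ∂(EMHD.spaceTime L T))
        (𝓝[>] 0) (𝓝 0)) ∧
    -- the energy is conserved
    ∃ E : ℝ, ∀ᵐ t ∂(volume.restrict (Ioo 0 T)), EMHD.energy (b t) = E :=
  ⟨hb.dissipation_vanishes hr₁ hr₂ hr hαβ hC₁ hC₂ hC₁_nonneg hC₂_nonneg hρ hσ₁ hσ₂ hσ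
    hb_incr hj_incr,
    hb.energy_conserved hT hr₁ hr₂ hr hαβ hC₁ hC₂ hC₁_nonneg hC₂_nonneg hρ hσ₁ hσ₂ hσ
    hb_incr hj_incr⟩
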